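/- Let $\mathcal T$ be a finite set with a probability distribution $P_\Theta$, and let a verification channel with inputs $(\theta,t)\in\mathcal T\times\{0,1\}$ and output $V$ be given, such that for $t=0$ the law of $V$ does not depend on $\theta$. All entropies and mutual informations are in bits. Let $I_{\mathrm{ver}}:=I(\Theta;V\mid T=1)$ for $\Theta\sim P_\Theta$. Fix $p\in(0,1)$, $\alpha\in(0,1)$ and a law on $\mathbb R$ without atoms such that a random variable $G$ with this law satisfies $\mathbb E[G]=0$, $\mathbb E[G^2]=1$ and $\mathbb E[|G|^3]<\infty$. Put $$q_\alpha:=\inf\{q:\mathbb P(G\le q)\ge 1-\alpha\},\qquad m_G(\alpha):=\tfrac1\alpha\,\mathbb E\big[G\,\mathbf 1\{G\ge q_\alpha\}\big],\qquad c_G(p,\alpha):=\sqrt{2\ln 2\;p(1-p)\,\alpha}\;m_G(\alpha).$$ Screening with strength $\varepsilon\ge0$: a record has a type $T\in\{0,1\}$ and a screening statistic $Z$, with Bayes score $\eta(z)=\mathbb P(T=1\mid Z=z)$, and there is a random variable $G$ with the above law such that almost surely $0<\eta(Z)<1$ and $$\ln\frac{\eta(Z)}{1-\eta(Z)}=\ln\frac{p}{1-p}+\varepsilon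 G .$$ (This determines $\mathbb P(T=1)=\mathbb E[\eta(Z)]=p+O(\varepsilon^2)$; the case $\mathbb P(T=1)=p$ is included, but equality is not required.) Let $J:=I(T;Z)$. A window has $K$ i.i.d. records $(\Theta_i,T_i,Z_i,V_i)$: the claim $\Theta_i\sim P_\Theta$ is independent of $(T_i,Z_i)$, which is distributed as $(T,Z)$, and given $(\Theta_i,T_i,Z_i)$ the output $V_i$ is drawn from the verification channel with input $(\Theta_i,T_i)$. Write $\Theta=(\Theta_1,\dots,\Theta_K)$. Let $B=\lfloor\alpha K\rfloor$. After observing $Z_1,\dots,Z_K$, verify $B$ records with the largest scores $\eta(Z_i)$ (ties broken by any measurable rule); verifying record $i$ reveals $(T_i,V_i)$. Let $D(K,B)$ be the Bayes-optimal expected log-loss (base $2$) for $\Theta$ given all the $Z_i$ and the verification transcript, that is, the infimum of $\mathbb E[-\log_2 q(\Theta)]$ over all measurable rules that choose a distribution $q$ on $\mathcal T^K$ from the observation. Then $$H(\Theta)-D(K,B)\;\ge\;\min\Big\{H(\Theta),\;I_{\mathrm{ver}}\big(Bp+c_G(p,\alpha)\sqrt{JKB}\big)\Big\}+o\big(\sqrt{JKB}\big)$$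 in the joint limit $\varepsilon\to0$, $K\to\infty$. That is, for every $\delta>0$ there are $\varepsilon_0>0$ and $K_0$, depending only on $\delta$, $P_\Theta$, the verification channel, $p$, $\alpha$ and the law of $G$, such that for all $0\le\varepsilon\le\varepsilon_0$ and $K\ge K_0$ the left side is at least the minimum minus $\delta\sqrt{JKB}$. -/

import Mathlib

open MeasureTheory ProbabilityTheory Set
open scoped ENNReal

noncomputable section

namespace ScoreVerification

/-! Information measures, in bits. -/

/-- Shannon entropy in bits of a probability measure on a finite set. -/
def entropyBits {X : Type*} [Fintype X] [MeasurableSpace X] (ρ : Measure X) : ℝ :=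
  (∑ x, Real.negMulLog (ρ.real {x})) / Real.log 2

/-- Mutual information in bits between the two coordinates under the joint law `ρ`: the
Kullback-Leibler divergence of `ρ` from the product of its marginals. It is used only when one
coordinate is finite-valued, and then the divergence is finite. -/
def mutualInfoBits {X Y : Type*} [MeasurableSpace X] [MeasurableSpace Y]
    (ρ : Measure (X × Y)) : ℝ :=
  (InformationTheory.klDiv ρ (ρ.fst.prod ρ.snd)).toReal / Real.log 2

/-- The logarithmic loss `-log₂ x` of having assigned probability `x` to the realized outcome;
it is infinite at `x = 0`. -/
def logLoss (x : ℝ) : ℝ≥0∞ :=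
  if x ≤ 0 then ⊤ else ENNReal.ofReal (-Real.logb 2 x)

/-! The distribution of the standardized score `G`, given by its law `ν`. -/

/-- The `(1 - α)`-quantile `inf {q : P(G ≤ q) ≥ 1 - α}`. -/
def upperQuantile (ν : Measure ℝ) (α : ℝ) : ℝ :=
  sInf {q : ℝ | 1 - α ≤ ν.real (Iic q)}

/-- The upper-tail mean `m_G(α) = E[G 1{G ≥ q_α}] / α`. -/
def tailMean (ν : Measure ℝ) (α : ℝ) : ℝ :=
  (1 / α) * ∫ g in Ici (upperQuantile ν α), g ∂ν

/-- The constant `c_G(p, α) = √(2 ln 2 · p (1 - p) α) · m_G(α)`. -/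
def gainConst (ν : Measure ℝ) (p α : ℝ) : ℝ :=
  Real.sqrt (2 * Real.log 2 * (p * (1 - p)) * α) * tailMean ν α

/-! Screening: `S` is the joint law of a type `T : Bool` and a screening statistic `Z : 𝒵`. -/

/-- `η` is a version of the Bayes score `z ↦ P(T = 1 ∣ Z = z)`. -/
def IsBayesScore {𝒵 : Type*} [MeasurableSpace 𝒵] (S : Measure (Bool × 𝒵)) (η : 𝒵 → ℝ) : Prop :=
  Measurable η ∧
    (fun x : Bool × 𝒵 => η x.2) =ᵐ[S]
      S⟦{x : Bool × 𝒵 | x.1 = true} | MeasurableSpace.comap Prod.snd inferInstance⟧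

/-- The weak-screening model with reference level `p` and strength `ε`: there is a random variable
`G` with law `ν`, defined jointly with `Z` (`ρ` is the joint law of `(Z, G)`), such that almost
surely `0 < η(Z) < 1` and `ln (η(Z) / (1 - η(Z))) = ln (p / (1 - p)) + ε G`. -/
def IsWeakScreening {𝒵 : Type*} [MeasurableSpace 𝒵] (S : Measure (Bool × 𝒵)) (η : 𝒵 → ℝ)
    (ν : Measure ℝ) (p ε : ℝ) : Prop :=
  ∃ ρ : Measure (𝒵 × ℝ), ρ.fst = S.snd ∧ ρ.snd = ν ∧
    ∀ᵐ x ∂ρ, η x.1 ∈ Ioo (0 : ℝ) 1 ∧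
      Real.log (η x.1 / (1 - η x.1)) = Real.log (p / (1 - p)) + ε * x.2

/-- A rule that, from the screening statistics of `K` records, selects `B` records with the
largest scores (ties may be broken in any measurable way). -/
structure IsTopSelection {𝒵 : Type*} [MeasurableSpace 𝒵] {K : ℕ} (η : 𝒵 → ℝ) (B : ℕ)
    (sel : (Fin K → 𝒵) → Finset (Fin K)) : Prop where
  measurableSet_fiber : ∀ s : Finset (Fin K), MeasurableSet {z | sel z = s}
  card_eq : ∀ z, (sel z).card = B
  score_le : ∀ z, ∀ i ∈ sel z, ∀ j ∉ sel z, η (z j) ≤ η (z i)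

/-! Verification. -/

/-- The law of `(Θ, V)` given `T = 1`. -/
def informativeLaw {𝒯 𝒱 : Type*} [MeasurableSpace 𝒯] [MeasurableSpace 𝒱]
    (prior : Measure 𝒯) (ver : Kernel (𝒯 × Bool) 𝒱) : Measure (𝒯 × 𝒱) :=
  prior ⊗ₘ ver.comap (fun θ => (θ, true)) (by fun_prop)

/-- `I_ver = I(Θ; V ∣ T = 1)`, in bits. -/
def verInfo {𝒯 𝒱 : Type*} [MeasurableSpace 𝒯] [MeasurableSpace 𝒱]
    (prior : Measure 𝒯) (ver : Kernel (𝒯 × Bool) 𝒱) : ℝ :=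
  mutualInfoBits (informativeLaw prior ver)

/-- The law of one record `((Θᵢ, Tᵢ, Zᵢ), Vᵢ)`: the claim `Θᵢ` has law `prior` and is independent
of `(Tᵢ, Zᵢ)`, which has law `S`; given `(Θᵢ, Tᵢ, Zᵢ)`, the output `Vᵢ` has law `ver (Θᵢ, Tᵢ)`. -/
def recordLaw {𝒯 𝒱 𝒵 : Type*} [MeasurableSpace 𝒯] [MeasurableSpace 𝒱] [MeasurableSpace 𝒵]
    (prior : Measure 𝒯) (ver : Kernel (𝒯 × Bool) 𝒱) (S : Measure (Bool × 𝒵)) :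
    Measure ((𝒯 × Bool × 𝒵) × 𝒱) :=
  (prior.prod S) ⊗ₘ ver.comap (fun x => (x.1, x.2.1)) (by fun_prop)

/-- The law of a window of `K` records with decoupled claims: the records are i.i.d. -/
def windowLaw {𝒯 𝒱 𝒵 : Type*} [MeasurableSpace 𝒯] [MeasurableSpace 𝒱] [MeasurableSpace 𝒵]
    (prior : Measure 𝒯) (ver : Kernel (𝒯 × Bool) 𝒱) (S : Measure (Bool × 𝒵)) (K : ℕ) :
    Measure (Fin K → (𝒯 × Bool × 𝒵) × 𝒱) :=
  Measure.pi fun _ => recordLaw prior ver S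

/-- What the agent observes in a window: all screening statistics, and for each record either
`(Tᵢ, Vᵢ)` if it is verified, or a blank symbol (`Sum.inl ()`) if it is not. -/
abbrev Observation (𝒵 𝒱 : Type*) (K : ℕ) : Type _ :=
  (Fin K → 𝒵) × (Fin K → Unit ⊕ (Bool × 𝒱))

/-- The observation produced by the selection rule `sel`. -/
def observe {𝒯 𝒱 𝒵 : Type*} {K : ℕ} (sel : (Fin K → 𝒵) → Finset (Fin K))
    (r : Fin K → (𝒯 × Bool × 𝒵) × 𝒱) : Observation 𝒵 𝒱 K :=
  (fun i => (r i).1.2.2,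
    fun i => if i ∈ sel (fun j => (r j).1.2.2) then Sum.inr ((r i).1.2.1, (r i).2)
      else Sum.inl ())

/-- `D(K, B)`: the Bayes-optimal expected log-loss for `Θ = (Θ₁, …, Θ_K)` after observing the
screening statistics and the verification transcript, that is, the infimum over all measurable
predictors `q` mapping an observation to a distribution on `𝒯^K`. -/
def bayesLogLoss {𝒯 𝒱 𝒵 : Type*} [Fintype 𝒯] [MeasurableSpace 𝒯] [MeasurableSpace 𝒱]
    [MeasurableSpace 𝒵] (prior : Measure 𝒯) (ver : Kernel (𝒯 × Bool) 𝒱)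
    (S : Measure (Bool × 𝒵)) {K : ℕ} (sel : (Fin K → 𝒵) → Finset (Fin K)) : ℝ≥0∞ :=
  ⨅ (q : Observation 𝒵 𝒱 K → (Fin K → 𝒯) → ℝ)
    (_ : Measurable q ∧ ∀ y, q y ∈ stdSimplex ℝ (Fin K → 𝒯)),
    ∫⁻ r, logLoss (q (observe sel r) (fun i => (r i).1.1)) ∂(windowLaw prior ver S K)

/-- `H(Θ)` for `Θ = (Θ₁, …, Θ_K)` i.i.d. with law `prior`. -/
def claimEntropy {𝒯 : Type*} [Fintype 𝒯] [MeasurableSpace 𝒯] (prior : Measure 𝒯) (K : ℕ) : ℝ :=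
  entropyBits (Measure.pi fun _ : Fin K => prior)

/-- The information gain `H(Θ) - D(K, B)`; here `D(K, B) ≤ K log₂ |𝒯|` is finite. -/
def gain {𝒯 𝒱 𝒵 : Type*} [Fintype 𝒯] [MeasurableSpace 𝒯] [MeasurableSpace 𝒱]
    [MeasurableSpace 𝒵] (prior : Measure 𝒯) (ver : Kernel (𝒯 × Bool) 𝒱)
    (S : Measure (Bool × 𝒵)) {K : ℕ} (sel : (Fin K → 𝒵) → Finset (Fin K)) : ℝ :=
  claimEntropy prior K - (bayesLogLoss prior ver S sel).toReal

end ScoreVerification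

end

open ScoreVerification

/-! The Bayes loss is an infimum over predictors, so one good predictor bounds the gain from below.
Take the product over records of the posterior of the claim given `V` under `T = 1` when a verified
record shows `T = 1`, and of the prior otherwise. Its loss is a sum over records. Freeze all records
but one: whether that record is selected depends only on its own statistic, and given a statistic
`z` the type is 1 with probability `η z`. A selected record therefore costs `H - η z * I_ver` on
average and any other costs `H`, where `H` is the entropy of a single claim. Hence the gain is at
least `I_ver` times the expected sum of the selected scores (`verInfo_mul_le_gain`).

It remains to bound that sum (`expected_informative_ge`). With `v = p (1 - p)`, Taylor expansion of
the logistic function gives `η = p + v ε G + O(ε² G²)`. The `B` largest scores have at least the sum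
of any `B` scores, in particular of those obtained from the exceedance set `{i : q_α ≤ G_i}` by
adding or removing a few indices. That set has mean size `α K` with fluctuations of order `√K`, and
the expected sum of `G` over it is `K α m_G`. So the expected sum of scores is at least `B p + v ε K
α m_G`, up to errors `τ v ε K` (with `τ` as small as desired) and `ε² K`
(`le_integral_sum_selection`).

Finally `J ln 2 = v ε² / 2 + O(ε³)` (`mutualInfoBits_screening_bounds`). Hence `c_G √(J K B)` is `v
ε K α m_G` to leading order, while `√(J K B)` is at least a constant times `ε K` and absorbs both
errors. All constants depend only on `δ`, `I_ver`, `p`, `α` and moments of `G`, whence the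
uniformity. -/

namespace ScoreVerification

/-! Estimates for the logistic function. -/

/-- Mean value inequality on the ball of radius `|u|`. The factor `1 / (n + 1)` that integration
would give is not needed. The cases `n = 0, 1, 2` yield the Taylor bounds below. -/
lemma abs_le_mul_abs_pow_succ_of_hasDerivAt {f f' : ℝ → ℝ} {C : ℝ} {n : ℕ} (hC : 0 ≤ C)
    (hf : ∀ x, HasDerivAt f (f' x) x) (h0 : f 0 = 0) (hb : ∀ x, |f' x| ≤ C * |x| ^ n) (u : ℝ) :
    |f u| ≤ C * |u| ^ (n + 1) := by
  have h := Convex.norm_image_sub_le_of_norm_hasDerivWithin_le (f := f) (f' := f')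
    (C := C * |u| ^ n) (s := Metric.closedBall (0 : ℝ) |u|) (x := 0) (y := u)
    (fun x _ => (hf x).hasDerivWithinAt)
    (fun x hx => by
      have hx' : |x| ≤ |u| := by simpa using hx
      rw [Real.norm_eq_abs]
      refine (hb x).trans ?_
      gcongr)
    (convex_closedBall _ _) (by simp) (by simp)
  rw [h0, sub_zero, sub_zero, Real.norm_eq_abs, Real.norm_eq_abs] at h
  calc |f u| ≤ C * |u| ^ n * |u| := h
    _ = _ := by ring

lemma abs_sigmoid_sub_le (x u : ℝ) : |Real.sigmoid (x + u) - Real.sigmoid x| ≤ |u| := by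
  have h := abs_le_mul_abs_pow_succ_of_hasDerivAt (n := 0) (C := 1)
    (f := fun u => Real.sigmoid (x + u) - Real.sigmoid x) (by norm_num)
    (fun y => ((Real.hasDerivAt_sigmoid (x + y)).comp_const_add x y).sub_const _) (by simp)
    (fun y => by
      have h1 := Real.sigmoid_pos (x + y)
      have h2 := Real.sigmoid_lt_one (x + y)
      rw [abs_of_pos (mul_pos h1 (by linarith))]
      nlinarith) u
  simpa using h

lemma abs_deriv_sigmoid_sub_le (x u : ℝ) :
    |Real.sigmoid (x + u) * (1 - Real.sigmoid (x + u))
      - Real.sigmoid x * (1 - Real.sigmoid x)| ≤ |u| := by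
  have h := abs_sigmoid_sub_le x u
  have h1 := Real.sigmoid_pos (x + u)
  have h2 := Real.sigmoid_lt_one (x + u)
  have h3 := Real.sigmoid_pos x
  have h4 := Real.sigmoid_lt_one x
  have e : Real.sigmoid (x + u) * (1 - Real.sigmoid (x + u))
      - Real.sigmoid x * (1 - Real.sigmoid x)
      = (Real.sigmoid (x + u) - Real.sigmoid x)
        * (1 - Real.sigmoid (x + u) - Real.sigmoid x) := by ring
  rw [e, abs_mul]
  have h5 : |1 - Real.sigmoid (x + u) - Real.sigmoid x| ≤ 1 := by
    rw [abs_le]; constructor <;> linarith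
  calc _ ≤ |u| * 1 := by gcongr
    _ = _ := mul_one _

lemma abs_sigmoid_sub_linear_le (x u : ℝ) :
    |Real.sigmoid (x + u) - Real.sigmoid x
      - Real.sigmoid x * (1 - Real.sigmoid x) * u| ≤ u ^ 2 := by
  have h := abs_le_mul_abs_pow_succ_of_hasDerivAt (n := 1) (C := 1)
    (f := fun u => Real.sigmoid (x + u) - Real.sigmoid x
      - Real.sigmoid x * (1 - Real.sigmoid x) * u) (by norm_num)
    (fun y => (((Real.hasDerivAt_sigmoid (x + y)).comp_const_add x y).sub_const _).sub
      ((hasDerivAt_id y).const_mul _)) (by simp)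
    (fun y => by simpa using abs_deriv_sigmoid_sub_le x y) u
  simpa using h

/-- The Kullback-Leibler divergence, in nats, between Bernoulli distributions. -/
noncomputable def binaryKL (a b : ℝ) : ℝ :=
  a * Real.log (a / b) + (1 - a) * Real.log ((1 - a) / (1 - b))

lemma binaryKL_self {a : ℝ} (ha : a ∈ Ioo (0 : ℝ) 1) : binaryKL a a = 0 := by
  have h1 : a ≠ 0 := ha.1.ne'
  have h2 : 1 - a ≠ 0 := by linarith [ha.2]
  simp [binaryKL, h1, h2]

lemma sigmoid_div_one_sub (x : ℝ) : Real.sigmoid x / (1 - Real.sigmoid x) = Real.exp x := by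
  rw [← Real.sigmoid_neg, ← Real.sigmoid_mul_rexp_neg, Real.exp_neg]
  have := (Real.sigmoid_pos x).ne'
  field_simp

lemma log_sigmoid_sub_log_one_sub (x : ℝ) :
    Real.log (Real.sigmoid x) - Real.log (1 - Real.sigmoid x) = x := by
  have h3 := Real.sigmoid_pos x
  have h4 := Real.sigmoid_lt_one x
  rw [← Real.log_div h3.ne' (by linarith), sigmoid_div_one_sub, Real.log_exp]

lemma eq_sigmoid_of_logit {a x : ℝ} (ha : a ∈ Ioo (0 : ℝ) 1) (h : Real.log (a / (1 - a)) = x) :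
    a = Real.sigmoid x := by
  have h1 : 0 < 1 - a := by linarith [ha.2]
  have h2 : a / (1 - a) = Real.exp x := by
    rw [← h, Real.exp_log (div_pos ha.1 h1)]
  have h3 := (Real.exp_pos x).ne'
  rw [Real.sigmoid_def, Real.exp_neg, ← h2]
  have := ha.1.ne'
  field_simp
  ring

lemma binaryKL_sigmoid (x u : ℝ) :
    binaryKL (Real.sigmoid (x + u)) (Real.sigmoid x) =
      Real.sigmoid (x + u) * u
        + (Real.log (1 - Real.sigmoid (x + u)) - Real.log (1 - Real.sigmoid x)) := by
  have h1 := Real.sigmoid_pos (x + u)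
  have h2 := Real.sigmoid_lt_one (x + u)
  have h3 := Real.sigmoid_pos x
  have h4 := Real.sigmoid_lt_one x
  have e1 := log_sigmoid_sub_log_one_sub (x + u)
  have e2 := log_sigmoid_sub_log_one_sub x
  rw [binaryKL, Real.log_div h1.ne' h3.ne', Real.log_div (by linarith) (by linarith),
    show Real.log (Real.sigmoid (x + u)) = x + u + Real.log (1 - Real.sigmoid (x + u)) by linarith,
    show Real.log (Real.sigmoid x) = x + Real.log (1 - Real.sigmoid x) by linarith]
  ring

/-- In logit coordinates the divergence has `u`-derivative `σ'(x + u) u`, because the two terms free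
of the factor `u` cancel. After subtraction of the quadratic term the derivative is `(σ'(x + u) -
σ'(x)) u`, which is at most `u ^ 2` in size. -/
lemma abs_binaryKL_sigmoid_sub_le (x u : ℝ) :
    |binaryKL (Real.sigmoid (x + u)) (Real.sigmoid x)
      - Real.sigmoid x * (1 - Real.sigmoid x) * u ^ 2 / 2| ≤ |u| ^ 3 := by
  have h := abs_le_mul_abs_pow_succ_of_hasDerivAt (n := 2) (C := 1)
    (f := fun u => Real.sigmoid (x + u) * u
        + (Real.log (1 - Real.sigmoid (x + u)) - Real.log (1 - Real.sigmoid x))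
        - Real.sigmoid x * (1 - Real.sigmoid x) * u ^ 2 / 2)
    (f' := fun u => (Real.sigmoid (x + u) * (1 - Real.sigmoid (x + u))
      - Real.sigmoid x * (1 - Real.sigmoid x)) * u) (by norm_num)
    (fun y => by
      have hs := (Real.hasDerivAt_sigmoid (x + y)).comp_const_add x y
      have hn : (1 - Real.sigmoid (x + y)) ≠ 0 := by linarith [Real.sigmoid_lt_one (x + y)]
      have h1 := (hs.mul (hasDerivAt_id y)).add (((hs.const_sub 1).log hn).sub_const
        (Real.log (1 - Real.sigmoid x)))
      have h2 := h1.sub ((((hasDerivAt_id y).pow 2).const_mul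
        (Real.sigmoid x * (1 - Real.sigmoid x))).div_const 2)
      refine h2.congr_deriv ?_
      simp only [id]
      field_simp
      push_cast
      ring) (by simp)
    (fun y => by
      rw [abs_mul]
      have := abs_deriv_sigmoid_sub_le x y
      calc _ ≤ |y| * |y| := by gcongr
        _ = _ := by ring) u
  rw [binaryKL_sigmoid]
  simpa using h

lemma binaryKL_nonneg {a b : ℝ} (ha : a ∈ Ioo (0 : ℝ) 1) (hb : b ∈ Ioo (0 : ℝ) 1) :
    0 ≤ binaryKL a b := by
  have ha1 : 0 < 1 - a := by linarith [ha.2]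
  have hb1 : 0 < 1 - b := by linarith [hb.2]
  have h1 := Real.one_sub_inv_le_log_of_pos (div_pos ha.1 hb.1)
  have h2 := Real.one_sub_inv_le_log_of_pos (div_pos ha1 hb1)
  have h3 := mul_le_mul_of_nonneg_left h1 ha.1.le
  have h4 := mul_le_mul_of_nonneg_left h2 ha1.le
  have e3 : a * (1 - (a / b)⁻¹) = a - b := by have := ha.1.ne'; field_simp
  have e4 : (1 - a) * (1 - ((1 - a) / (1 - b))⁻¹) = (1 - a) - (1 - b) := by
    field_simp
  unfold binaryKL
  linarith

lemma binaryKL_le {a b : ℝ} (ha : a ∈ Ioo (0 : ℝ) 1) (hb : b ∈ Ioo (0 : ℝ) 1) :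
    binaryKL a b ≤ (a - b) ^ 2 / (b * (1 - b)) := by
  have ha1 : 0 < 1 - a := by linarith [ha.2]
  have hb1 : 0 < 1 - b := by linarith [hb.2]
  have h1 := Real.log_le_sub_one_of_pos (div_pos ha.1 hb.1)
  have h2 := Real.log_le_sub_one_of_pos (div_pos ha1 hb1)
  have h3 := mul_le_mul_of_nonneg_left h1 ha.1.le
  have h4 := mul_le_mul_of_nonneg_left h2 ha1.le
  have e : a * (a / b - 1) + (1 - a) * ((1 - a) / (1 - b) - 1)
      = (a - b) ^ 2 / (b * (1 - b)) := by
    have := hb.1.ne'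
    field_simp
    ring
  unfold binaryKL
  linarith

/-- The correction term is affine in `a`. Averaged over scores `a` with mean `b`, it becomes
`binaryKL b c`, which lets the reference level `p` replace the true `P(T = 1)`. -/
lemma binaryKL_eq_sub {a b c : ℝ} (ha : a ∈ Ioo (0 : ℝ) 1) (hb : b ∈ Ioo (0 : ℝ) 1)
    (hc : c ∈ Ioo (0 : ℝ) 1) :
    binaryKL a b = binaryKL a c - (a * Real.log (b / c)
      + (1 - a) * Real.log ((1 - b) / (1 - c))) := by
  have ha1 : 1 - a ≠ 0 := by linarith [ha.2]
  have hb1 : 1 - b ≠ 0 := by linarith [hb.2]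
  have hc1 : 1 - c ≠ 0 := by linarith [hc.2]
  simp only [binaryKL, Real.log_div ha.1.ne' hb.1.ne', Real.log_div ha.1.ne' hc.1.ne',
    Real.log_div hb.1.ne' hc.1.ne', Real.log_div ha1 hb1, Real.log_div ha1 hc1,
    Real.log_div hb1 hc1]
  ring

/-- `a log a` is bounded on the unit interval, hence so is the binary divergence. -/
lemma abs_mul_log_div_le {a b : ℝ} (ha : a ∈ Ioo (0 : ℝ) 1) (hb : b ∈ Ioo (0 : ℝ) 1) :
    |a * Real.log (a / b)| ≤ 1 / b := by
  have h1 := Real.log_le_sub_one_of_pos (div_pos ha.1 hb.1)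
  have h2 := Real.one_sub_inv_le_log_of_pos (div_pos ha.1 hb.1)
  have h3 := mul_le_mul_of_nonneg_left h1 ha.1.le
  have h4 := mul_le_mul_of_nonneg_left h2 ha.1.le
  have e4 : a * (1 - (a / b)⁻¹) = a - b := by have := ha.1.ne'; field_simp
  have hb' : 1 < 1 / b := by rw [lt_div_iff₀ hb.1]; linarith [hb.2]
  rw [abs_le]
  constructor
  · have := hb.2; have := ha.1; linarith
  · have h5 : a / b ≤ 1 / b := by gcongr; exacts [hb.1.le, ha.2.le]
    have h6 : a * (a / b - 1) ≤ a * (1 / b) := mul_le_mul_of_nonneg_left (by linarith) ha.1.le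
    have h7 : a * (1 / b) ≤ 1 * (1 / b) :=
      mul_le_mul_of_nonneg_right ha.2.le (by linarith)
    linarith

/-! The joint law of a type and a screening statistic in terms of the Bayes score. -/

section Screening

variable {𝒵 : Type*} [MeasurableSpace 𝒵] {S : Measure (Bool × 𝒵)} [IsProbabilityMeasure S]
  {η : 𝒵 → ℝ}

lemma measure_true_prod (hη : IsBayesScore S η) (h01 : ∀ᵐ z ∂S.snd, η z ∈ Ioo (0 : ℝ) 1)
    {A : Set 𝒵} (hA : MeasurableSet A) :
    S ({true} ×ˢ A) = ∫⁻ z in A, ENNReal.ofReal (η z) ∂S.snd := by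
  have h01' : ∀ᵐ x ∂S, η x.2 ∈ Ioo (0 : ℝ) 1 :=
    ae_of_ae_map measurable_snd.aemeasurable h01
  have hE : MeasurableSet {x : Bool × 𝒵 | x.1 = true} :=
    measurable_fst (measurableSet_singleton true)
  have hint : Integrable (fun x : Bool × 𝒵 => η x.2) S :=
    Integrable.of_bound (hη.1.comp measurable_snd).aestronglyMeasurable 1
      (h01'.mono fun x hx => by
        rw [Real.norm_eq_abs, abs_le]; constructor <;> linarith [hx.1, hx.2])
  have hm : MeasurableSpace.comap Prod.snd inferInstance ≤
    (inferInstance : MeasurableSpace (Bool × 𝒵)) := measurable_snd.comap_le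
  have h1 : ∫ x in Prod.snd ⁻¹' A, η x.2 ∂S
      = ∫ x in Prod.snd ⁻¹' A, ({x : Bool × 𝒵 | x.1 = true}.indicator (fun _ => (1 : ℝ))) x ∂S := by
    rw [← setIntegral_condExp hm ((integrable_const (1 : ℝ)).indicator hE) ⟨A, hA, rfl⟩]
    exact integral_congr_ae (ae_restrict_of_ae hη.2)
  have h2 : ∫ x in Prod.snd ⁻¹' A, ({x : Bool × 𝒵 | x.1 = true}.indicator (fun _ => (1 : ℝ))) x ∂S
      = S.real ({true} ×ˢ A) := by
    rw [integral_indicator hE, setIntegral_const, smul_eq_mul, mul_one,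
      measureReal_restrict_apply hE]
    congr 1
  rw [Measure.snd, setLIntegral_map hA (hη.1.ennreal_ofReal) measurable_snd,
    ← ofReal_integral_eq_lintegral_ofReal hint.integrableOn
      (ae_restrict_of_ae (h01'.mono fun x hx => hx.1.le)), h1, h2, Measure.real,
    ENNReal.ofReal_toReal (measure_ne_top _ _)]

/-- Disintegration of `S` over the type. Integrals over `(T, Z)` become integrals over `Z` with
weights `η` and `1 - η`, so conditional expectations are not needed again. -/
lemma eq_map_true_add_map_false (hη : IsBayesScore S η)
    (h01 : ∀ᵐ z ∂S.snd, η z ∈ Ioo (0 : ℝ) 1) :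
    S = (S.snd.withDensity fun z => ENNReal.ofReal (η z)).map (Prod.mk true)
      + (S.snd.withDensity fun z => ENNReal.ofReal (1 - η z)).map (Prod.mk false) := by
  ext A hA
  have hT : MeasurableSet (Prod.mk true ⁻¹' A : Set 𝒵) := measurable_prodMk_left hA
  have hF : MeasurableSet (Prod.mk false ⁻¹' A : Set 𝒵) := measurable_prodMk_left hA
  have hsplit : ∀ C : Set 𝒵, MeasurableSet C →
      S.snd C = S ({true} ×ˢ C) + S ({false} ×ˢ C) := by
    intro C hC
    rw [Measure.snd_apply hC, ← measure_union _ ((measurableSet_singleton _).prod hC)]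
    · congr 1
      ext ⟨t, z⟩
      cases t <;> simp
    · rw [Set.disjoint_left]
      rintro ⟨t, z⟩ h1 h2
      simp at h1 h2
      simp_all
  have hfalse : S ({false} ×ˢ (Prod.mk false ⁻¹' A))
      = ∫⁻ z in (Prod.mk false ⁻¹' A), ENNReal.ofReal (1 - η z) ∂S.snd := by
    have h := hsplit _ hF
    rw [measure_true_prod hη h01 hF] at h
    have h3 : S.snd (Prod.mk false ⁻¹' A)
        = ∫⁻ z in (Prod.mk false ⁻¹' A), ENNReal.ofReal (η z) ∂S.snd
          + ∫⁻ z in (Prod.mk false ⁻¹' A), ENNReal.ofReal (1 - η z) ∂S.snd := by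
      rw [← lintegral_add_left hη.1.ennreal_ofReal, ← setLIntegral_one]
      refine lintegral_congr_ae (ae_restrict_of_ae (h01.mono fun z hz => ?_))
      simp only
      rw [← ENNReal.ofReal_add hz.1.le (by linarith [hz.2])]
      simp
    rw [h] at h3
    refine (ENNReal.add_right_inj ?_).1 h3
    rw [← measure_true_prod hη h01 hF]
    exact measure_ne_top _ _
  rw [Measure.add_apply, Measure.map_apply measurable_prodMk_left hA,
    Measure.map_apply measurable_prodMk_left hA, withDensity_apply _ hT, withDensity_apply _ hF,
    ← measure_true_prod hη h01 hT, ← hfalse,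
    ← measure_union _ ((measurableSet_singleton _).prod hF)]
  · congr 1
    ext ⟨t, z⟩
    cases t <;> simp
  · rw [Set.disjoint_left]
    rintro ⟨t, z⟩ h1 h2
    simp at h1 h2
    simp_all

lemma lintegral_eq_lintegral_score (hη : IsBayesScore S η)
    (h01 : ∀ᵐ z ∂S.snd, η z ∈ Ioo (0 : ℝ) 1) {F : Bool × 𝒵 → ℝ≥0∞} (hF : Measurable F) :
    ∫⁻ x, F x ∂S = ∫⁻ z, (ENNReal.ofReal (η z) * F (true, z)
      + ENNReal.ofReal (1 - η z) * F (false, z)) ∂S.snd := by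
  have hm := hη.1
  conv_lhs => rw [eq_map_true_add_map_false hη h01]
  rw [lintegral_add_measure, lintegral_map hF measurable_prodMk_left,
    lintegral_map hF measurable_prodMk_left,
    lintegral_withDensity_eq_lintegral_mul _ (by fun_prop) (by fun_prop),
    lintegral_withDensity_eq_lintegral_mul _ (by fun_prop) (by fun_prop),
    ← lintegral_add_left (by fun_prop)]
  rfl

lemma integral_eq_integral_score (hη : IsBayesScore S η)
    (h01 : ∀ᵐ z ∂S.snd, η z ∈ Ioo (0 : ℝ) 1) {F : Bool × 𝒵 → ℝ} (hF : Measurable F)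
    (hT : Integrable (fun z => η z * F (true, z)) S.snd)
    (hT' : Integrable (fun z => (1 - η z) * F (false, z)) S.snd) :
    ∫ x, F x ∂S = ∫ z, (η z * F (true, z) + (1 - η z) * F (false, z)) ∂S.snd := by
  have hm := hη.1
  have e1 : ∀ᵐ z ∂S.snd, (ENNReal.ofReal (η z)).toReal • F (true, z) = η z * F (true, z) :=
    h01.mono fun z hz => by rw [ENNReal.toReal_ofReal hz.1.le, smul_eq_mul]
  have e2 : ∀ᵐ z ∂S.snd,
      (ENNReal.ofReal (1 - η z)).toReal • F (false, z) = (1 - η z) * F (false, z) :=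
    h01.mono fun z hz => by rw [ENNReal.toReal_ofReal (by linarith [hz.2]), smul_eq_mul]
  have i1 : Integrable F ((S.snd.withDensity fun z => ENNReal.ofReal (η z)).map (Prod.mk true)) := by
    rw [integrable_map_measure hF.aestronglyMeasurable (by fun_prop),
      integrable_withDensity_iff_integrable_smul' (by fun_prop) (by simp)]
    exact hT.congr (e1.mono fun z hz => hz.symm)
  have i2 : Integrable F
      ((S.snd.withDensity fun z => ENNReal.ofReal (1 - η z)).map (Prod.mk false)) := by
    rw [integrable_map_measure hF.aestronglyMeasurable (by fun_prop),
      integrable_withDensity_iff_integrable_smul' (by fun_prop) (by simp)]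
    exact hT'.congr (e2.mono fun z hz => hz.symm)
  conv_lhs => rw [eq_map_true_add_map_false hη h01]
  rw [integral_add_measure i1 i2, integral_map (by fun_prop) hF.aestronglyMeasurable,
    integral_map (by fun_prop) hF.aestronglyMeasurable,
    integral_withDensity_eq_integral_toReal_smul (by fun_prop) (by simp),
    integral_withDensity_eq_integral_toReal_smul (by fun_prop) (by simp),
    integral_congr_ae e1, integral_congr_ae e2, integral_add hT hT']

lemma toReal_klDiv_of_eq_withDensity {X : Type*} [MeasurableSpace X] {μ ν : Measure X}
    [IsProbabilityMeasure μ] [IsProbabilityMeasure ν] {f : X → ℝ≥0∞} (hf : Measurable f)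
    (h : μ = ν.withDensity f) :
    (InformationTheory.klDiv μ ν).toReal = ∫ x, Real.log (f x).toReal ∂μ := by
  have hac : μ ≪ ν := h ▸ withDensity_absolutelyContinuous _ _
  rw [InformationTheory.toReal_klDiv_of_measure_eq hac (by simp)]
  refine integral_congr_ae ?_
  have := hac.ae_le (h ▸ Measure.rnDeriv_withDensity ν hf : μ.rnDeriv ν =ᵐ[ν] f)
  filter_upwards [this] with x hx
  rw [llr, hx]

lemma integrable_score (hη : IsBayesScore S η) (h01 : ∀ᵐ z ∂S.snd, η z ∈ Ioo (0 : ℝ) 1) :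
    Integrable η S.snd :=
  Integrable.of_bound hη.1.aestronglyMeasurable 1
    (h01.mono fun x hx => by rw [Real.norm_eq_abs, abs_le]; constructor <;> linarith [hx.1, hx.2])

lemma integral_mem_Ioo {X : Type*} [MeasurableSpace X] {μ : Measure X} [IsProbabilityMeasure μ]
    {f : X → ℝ} (hf : Integrable f μ) (h01 : ∀ᵐ z ∂μ, f z ∈ Ioo (0 : ℝ) 1) :
    ∫ z, f z ∂μ ∈ Ioo (0 : ℝ) 1 := by
  have pos : ∀ g : X → ℝ, Integrable g μ → (∀ᵐ z ∂μ, 0 < g z) → 0 < ∫ z, g z ∂μ := by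
    intro g hg h
    rw [integral_pos_iff_support_of_nonneg_ae (h.mono fun z hz => hz.le) hg]
    have : μ (Function.support g) = 1 := by
      rw [← measure_univ (μ := μ)]
      exact measure_congr (Filter.eventuallyEq_set.2 (h.mono fun z hz => by simp [hz.ne']))
    simp [this]
  constructor
  · exact pos f hf (h01.mono fun z hz => hz.1)
  · have := pos (fun z => 1 - f z) ((integrable_const 1).sub hf)
      (h01.mono fun z hz => by linarith [hz.2])
    rw [integral_sub (integrable_const 1) hf] at this
    simp at this
    linarith

lemma integrable_binaryKL (hη : IsBayesScore S η) (h01 : ∀ᵐ z ∂S.snd, η z ∈ Ioo (0 : ℝ) 1)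
    {b : ℝ} (hb : b ∈ Ioo (0 : ℝ) 1) :
    Integrable (fun z => η z * Real.log (η z / b)) S.snd ∧
      Integrable (fun z => (1 - η z) * Real.log ((1 - η z) / (1 - b))) S.snd := by
  have hm := hη.1
  constructor
  · exact Integrable.of_bound (Measurable.aestronglyMeasurable (by fun_prop)) (1 / b)
      (h01.mono fun z hz => abs_mul_log_div_le hz hb)
  · exact Integrable.of_bound (Measurable.aestronglyMeasurable (by fun_prop)) (1 / (1 - b))
      (h01.mono fun z hz => abs_mul_log_div_le (a := 1 - η z) (b := 1 - b)
        ⟨by linarith [hz.2], by linarith [hz.1]⟩ ⟨by linarith [hb.2], by linarith [hb.1]⟩)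

/-- The mutual information of type and screening statistic is the mean binary divergence of the
Bayes score from the prior probability. -/
lemma mutualInfoBits_mul_log_two (hη : IsBayesScore S η)
    (h01 : ∀ᵐ z ∂S.snd, η z ∈ Ioo (0 : ℝ) 1) :
    mutualInfoBits S * Real.log 2 = ∫ z, binaryKL (η z) (∫ z, η z ∂S.snd) ∂S.snd := by
  have hm := hη.1
  set b := ∫ z, η z ∂S.snd with hbdef
  have hb : b ∈ Ioo (0 : ℝ) 1 := integral_mem_Ioo (integrable_score hη h01) h01
  have hb1 : 0 < 1 - b := by linarith [hb.2]
  have hfT : S.fst {true} = ENNReal.ofReal b := by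
    rw [Measure.fst_apply (measurableSet_singleton _), hbdef,
      ofReal_integral_eq_lintegral_ofReal (integrable_score hη h01)
        (h01.mono fun z hz => hz.1.le), ← setLIntegral_univ,
        ← measure_true_prod hη h01 MeasurableSet.univ]
    congr 1
    ext x; simp
  have hfF : S.fst {false} = ENNReal.ofReal (1 - b) := by
    have h1 : S.fst.real {true} = b := by rw [Measure.real, hfT, ENNReal.toReal_ofReal hb.1.le]
    have h2 := probReal_compl_eq_one_sub (μ := S.fst) (measurableSet_singleton true)
    rw [h1] at h2
    rw [← h2, Measure.real, ENNReal.ofReal_toReal (measure_ne_top _ _)]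
    congr 1
    ext x; simp
  -- By Bayes' rule this is the density of the joint law with respect to the product of its
  -- marginals; the mean of its logarithm is the divergence.
  let f : Bool × 𝒵 → ℝ := fun x => if x.1 = true then η x.2 / b else (1 - η x.2) / (1 - b)
  have hf : Measurable f := Measurable.ite (measurable_fst (measurableSet_singleton true))
    (by fun_prop) (by fun_prop)
  have hS : S = (S.fst.prod S.snd).withDensity fun x => ENNReal.ofReal (f x) := by
    ext A hA
    rw [withDensity_apply _ hA, ← lintegral_indicator hA,
      lintegral_prod _ (by fun_prop), lintegral_fintype, ← lintegral_indicator_one hA,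
      lintegral_eq_lintegral_score hη h01 (measurable_one.indicator hA)]
    have hmA : Measurable (A.indicator fun x => ENNReal.ofReal (f x)) := by fun_prop
    have hmA1 : Measurable (A.indicator (1 : Bool × 𝒵 → ℝ≥0∞)) := measurable_one.indicator hA
    rw [Fintype.sum_bool, hfT, hfF, ← lintegral_mul_const _ (by fun_prop),
      ← lintegral_mul_const _ (by fun_prop), ← lintegral_add_left (by fun_prop)]
    refine lintegral_congr_ae (h01.mono fun z hz => ?_)
    simp only
    congr 1
    · by_cases h : (true, z) ∈ A
      · have hd : 0 ≤ η z / b := div_nonneg hz.1.le hb.1.le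
        simp only [indicator_of_mem h, Pi.one_apply, mul_one, f, if_true]
        rw [← ENNReal.ofReal_mul hd, div_mul_cancel₀ _ hb.1.ne']
      · simp [indicator_of_notMem h]
    · by_cases h : (false, z) ∈ A
      · have hd : 0 ≤ (1 - η z) / (1 - b) := div_nonneg (by linarith [hz.2]) hb1.le
        simp only [indicator_of_mem h, Pi.one_apply, mul_one, f]
        simp only [Bool.false_eq_true, if_false]
        rw [← ENNReal.ofReal_mul hd, div_mul_cancel₀ _ hb1.ne']
      · simp [indicator_of_notMem h]
  have h01' : ∀ᵐ x ∂S, η x.2 ∈ Ioo (0 : ℝ) 1 :=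
    ae_of_ae_map measurable_snd.aemeasurable h01
  obtain ⟨i1, i2⟩ := integrable_binaryKL hη h01 hb
  rw [mutualInfoBits, div_mul_cancel₀ _ (Real.log_pos one_lt_two).ne',
    toReal_klDiv_of_eq_withDensity hf.ennreal_ofReal hS]
  have e : ∀ᵐ x ∂S, Real.log (ENNReal.ofReal (f x)).toReal = Real.log (f x) := by
    filter_upwards [h01'] with x hx
    rw [ENNReal.toReal_ofReal]
    simp only [f]
    split_ifs
    · exact div_nonneg hx.1.le hb.1.le
    · exact div_nonneg (by linarith [hx.2]) hb1.le
  rw [integral_congr_ae e, integral_eq_integral_score hη h01 (by fun_prop)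
    (by simpa [f] using i1) (by simpa [f] using i2)]
  simp [f, binaryKL]

/-- Replacing the prior probability by a reference level `p` in the mean binary divergence. -/
lemma mutualInfoBits_mul_log_two_eq_sub (hη : IsBayesScore S η)
    (h01 : ∀ᵐ z ∂S.snd, η z ∈ Ioo (0 : ℝ) 1) {p : ℝ} (hp : p ∈ Ioo (0 : ℝ) 1) :
    mutualInfoBits S * Real.log 2 = ∫ z, binaryKL (η z) p ∂S.snd
      - binaryKL (∫ z, η z ∂S.snd) p := by
  rw [mutualInfoBits_mul_log_two hη h01]
  have hint := integrable_score hη h01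
  set b := ∫ z, η z ∂S.snd with hbdef
  have hb : b ∈ Ioo (0 : ℝ) 1 := integral_mem_Ioo hint h01
  have e : ∀ᵐ z ∂S.snd, binaryKL (η z) b = binaryKL (η z) p -
      (η z * Real.log (b / p) + (1 - η z) * Real.log ((1 - b) / (1 - p))) :=
    h01.mono fun z hz => binaryKL_eq_sub hz hb hp
  obtain ⟨i1, i2⟩ := integrable_binaryKL hη h01 hp
  have i3 : Integrable (fun z => binaryKL (η z) p) S.snd := i1.add i2
  have i4 := hint.mul_const (Real.log (b / p))
  have i5 := ((integrable_const (1 : ℝ)).sub hint).mul_const (Real.log ((1 - b) / (1 - p)))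
  simp only [Pi.sub_apply] at i5
  have i6 : Integrable (fun z => η z * Real.log (b / p)
      + (1 - η z) * Real.log ((1 - b) / (1 - p))) S.snd := i4.add i5
  rw [integral_congr_ae e, integral_sub i3 i6, integral_add i4 i5, integral_mul_const,
    integral_mul_const, integral_sub (integrable_const _) hint]
  simp [binaryKL, ← hbdef]

end Screening

/-! Logarithmic loss and entropy. -/

lemma logLoss_one : logLoss 1 = 0 := by simp [logLoss]

lemma logLoss_of_pos {x : ℝ} (hx : 0 < x) : logLoss x = ENNReal.ofReal (-Real.logb 2 x) := by
  simp [logLoss, hx.not_ge]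

lemma toReal_logLoss {x : ℝ} (hx : 0 < x) (hx1 : x ≤ 1) : (logLoss x).toReal = -Real.logb 2 x := by
  rw [logLoss_of_pos hx, ENNReal.toReal_ofReal]
  have := Real.logb_nonpos one_lt_two hx.le hx1
  linarith

@[fun_prop]
lemma measurable_logLoss : Measurable logLoss := by
  unfold logLoss
  refine Measurable.ite measurableSet_Iic measurable_const ?_
  unfold Real.logb
  fun_prop

lemma logLoss_mul {x y : ℝ} (hx : x ∈ Icc (0 : ℝ) 1) (hy : y ∈ Icc (0 : ℝ) 1) :
    logLoss (x * y) = logLoss x + logLoss y := by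
  rcases hx.1.eq_or_lt with h | h
  · simp [logLoss, ← h]
  rcases hy.1.eq_or_lt with h' | h'
  · simp [logLoss, ← h']
  have h1 := Real.logb_nonpos one_lt_two h.le hx.2
  have h2 := Real.logb_nonpos one_lt_two h'.le hy.2
  rw [logLoss_of_pos h, logLoss_of_pos h', logLoss_of_pos (mul_pos h h'),
    ← ENNReal.ofReal_add (by linarith) (by linarith), Real.logb_mul h.ne' h'.ne']
  congr 1
  ring

lemma logLoss_prod {ι : Type*} (s : Finset ι) {x : ι → ℝ} (hx : ∀ i, x i ∈ Icc (0 : ℝ) 1) :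
    logLoss (∏ i ∈ s, x i) = ∑ i ∈ s, logLoss (x i) := by
  classical
  induction s using Finset.induction_on with
  | empty => simp [logLoss_one]
  | insert a s ha ih =>
    rw [Finset.prod_insert ha, Finset.sum_insert ha, logLoss_mul (hx a), ih]
    exact ⟨Finset.prod_nonneg fun i _ => (hx i).1,
      Finset.prod_le_one (fun i _ => (hx i).1) fun i _ => (hx i).2⟩

/-- At `x = 0` the convention `⊤ * 0 = 0` matches `0 log 0 = 0`, so outcomes of probability zero
cost nothing. -/
lemma logLoss_mul_ofReal {x : ℝ} (hx : x ∈ Icc (0 : ℝ) 1) :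
    logLoss x * ENNReal.ofReal x = ENNReal.ofReal (Real.negMulLog x / Real.log 2) := by
  rcases hx.1.eq_or_lt with h | h
  · simp [← h]
  have h1 := Real.logb_nonpos one_lt_two h.le hx.2
  rw [logLoss_of_pos h, ← ENNReal.ofReal_mul (by linarith), Real.negMulLog, Real.logb]
  congr 1
  ring

lemma measureReal_mem_Icc {X : Type*} [MeasurableSpace X] (ρ : Measure X) [IsProbabilityMeasure ρ]
    (s : Set X) : ρ.real s ∈ Icc (0 : ℝ) 1 := ⟨measureReal_nonneg, measureReal_le_one⟩

section Entropy

variable {X : Type*} [Fintype X] [MeasurableSpace X]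

lemma entropyBits_nonneg (ρ : Measure X) [IsProbabilityMeasure ρ] : 0 ≤ entropyBits ρ :=
  div_nonneg (Finset.sum_nonneg fun _ _ =>
    Real.negMulLog_nonneg measureReal_nonneg measureReal_le_one) (Real.log_pos one_lt_two).le

variable [MeasurableSingletonClass X]

lemma ofReal_entropyBits (ρ : Measure X) [IsProbabilityMeasure ρ] :
    ENNReal.ofReal (entropyBits ρ) = ∫⁻ x, logLoss (ρ.real {x}) ∂ρ := by
  rw [lintegral_fintype, entropyBits, Finset.sum_div, ENNReal.ofReal_sum_of_nonneg]
  · refine Finset.sum_congr rfl fun x _ => ?_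
    rw [← logLoss_mul_ofReal (measureReal_mem_Icc ρ _), Measure.real,
      ENNReal.ofReal_toReal (measure_ne_top _ _)]
  · intro x _
    exact div_nonneg (Real.negMulLog_nonneg measureReal_nonneg measureReal_le_one)
      (Real.log_pos one_lt_two).le

lemma ofReal_claimEntropy (ρ : Measure X) [IsProbabilityMeasure ρ] (K : ℕ) :
    ENNReal.ofReal (claimEntropy ρ K) = K * ENNReal.ofReal (entropyBits ρ) := by
  rw [claimEntropy, ofReal_entropyBits, ofReal_entropyBits]
  have h : ∀ x : Fin K → X, logLoss ((Measure.pi fun _ : Fin K => ρ).real {x})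
      = ∑ i, logLoss (ρ.real {x i}) := by
    intro x
    rw [← logLoss_prod _ fun i => measureReal_mem_Icc ρ _]
    simp [Measure.real, ← univ_pi_singleton, Measure.pi_pi, ENNReal.toReal_prod]
  simp_rw [h]
  rw [lintegral_finsetSum _ fun i _ => by fun_prop]
  have h2 : ∀ i : Fin K, ∫⁻ x : Fin K → X, logLoss (ρ.real {x i}) ∂(Measure.pi fun _ => ρ)
      = ∫⁻ x, logLoss (ρ.real {x}) ∂ρ := fun i =>
    (measurePreserving_eval (fun _ : Fin K => ρ) i).lintegral_comp
      (f := fun x => logLoss (ρ.real {x})) (by fun_prop)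
  simp [h2]

end Entropy

/-! The posterior of a claim given an informative output. -/

section Posterior

variable {𝒯 : Type*} [Fintype 𝒯] [MeasurableSpace 𝒯] [MeasurableSingletonClass 𝒯] [Nonempty 𝒯]
  {𝒱 : Type*} [MeasurableSpace 𝒱]

/-- The conditional law of the first coordinate given the second. -/
noncomputable def claimPosterior (ρ : Measure (𝒯 × 𝒱)) [IsFiniteMeasure ρ] : Kernel 𝒱 𝒯 :=
  (ρ.map Prod.swap).condKernel

variable (ρ : Measure (𝒯 × 𝒱)) [IsProbabilityMeasure ρ]

instance : IsMarkovKernel (claimPosterior ρ) := by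
  unfold claimPosterior; infer_instance

lemma lintegral_eq_lintegral_posterior {g : 𝒯 × 𝒱 → ℝ≥0∞} (hg : Measurable g) :
    ∫⁻ x, g x ∂ρ = ∫⁻ v, ∑ θ, g (θ, v) * claimPosterior ρ v {θ} ∂ρ.snd := by
  have h1 : ∫⁻ x, g x ∂ρ = ∫⁻ x, g x.swap ∂(ρ.map Prod.swap) := by
    rw [lintegral_map (by fun_prop) measurable_swap]
    simp
  have h2 : (ρ.map Prod.swap).fst ⊗ₘ claimPosterior ρ = ρ.map Prod.swap :=
    (ρ.map Prod.swap).disintegrate (ρ.map Prod.swap).condKernel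
  rw [h1, ← h2, Measure.lintegral_compProd (by fun_prop), Measure.fst_map_swap]
  refine lintegral_congr fun v => ?_
  rw [lintegral_fintype]
  rfl

lemma measurable_posterior_apply (θ : 𝒯) : Measurable fun v => claimPosterior ρ v {θ} :=
  Kernel.measurable_coe _ (measurableSet_singleton _)

lemma measurable_posterior_real :
    Measurable fun x : 𝒯 × 𝒱 => (claimPosterior ρ x.2).real {x.1} :=
  measurable_from_prod_countable_right fun θ => (measurable_posterior_apply ρ θ).ennreal_toReal

lemma ae_posterior_eq_zero {θ : 𝒯} (h : ρ.fst {θ} = 0) :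
    ∀ᵐ v ∂ρ.snd, claimPosterior ρ v {θ} = 0 := by
  have h1 := lintegral_eq_lintegral_posterior ρ
    (g := (Prod.fst ⁻¹' {θ}).indicator 1) (measurable_one.indicator
      (measurable_fst (measurableSet_singleton θ)))
  rw [lintegral_indicator_one (measurable_fst (measurableSet_singleton θ)),
    ← Measure.fst_apply (measurableSet_singleton θ), h] at h1
  have h2 : ∫⁻ v, claimPosterior ρ v {θ} ∂ρ.snd = 0 := by
    rw [← nonpos_iff_eq_zero, h1]
    refine lintegral_mono fun v => ?_
    have := Finset.single_le_sum (f := fun θ' =>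
      ((Prod.fst ⁻¹' {θ}).indicator 1 : 𝒯 × 𝒱 → ℝ≥0∞) (θ', v) * claimPosterior ρ v {θ'})
      (fun _ _ => zero_le) (Finset.mem_univ θ)
    simpa using this
  exact (lintegral_eq_zero_iff (measurable_posterior_apply ρ θ)).1 h2

/-- Bayes' rule once more. A claim of prior mass zero makes the quotient a division by zero; this is
harmless because its posterior mass vanishes almost surely as well. -/
lemma eq_withDensity_posterior :
    ρ = (ρ.fst.prod ρ.snd).withDensity fun x =>
      ENNReal.ofReal ((claimPosterior ρ x.2).real {x.1} / ρ.fst.real {x.1}) := by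
  have hm := measurable_posterior_real ρ
  have hm1 : Measurable fun x : 𝒯 × 𝒱 => ρ.fst.real {x.1} :=
    (Measurable.of_discrete (f := fun θ => ρ.fst.real {θ})).comp measurable_fst
  ext A hA
  rw [withDensity_apply _ hA, ← lintegral_indicator hA,
      lintegral_prod_symm _ (by fun_prop), ← lintegral_indicator_one hA,
      lintegral_eq_lintegral_posterior ρ (measurable_one.indicator hA)]
  have hae : ∀ᵐ v ∂ρ.snd, ∀ θ, ρ.fst {θ} = 0 → claimPosterior ρ v {θ} = 0 := by
    rw [ae_all_iff]
    intro θ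
    by_cases h : ρ.fst {θ} = 0
    · filter_upwards [ae_posterior_eq_zero ρ h] with v hv _ using hv
    · simp [h]
  refine lintegral_congr_ae (hae.mono fun v hv => ?_)
  simp only
  rw [lintegral_fintype]
  refine Finset.sum_congr rfl fun θ _ => ?_
  by_cases h : (θ, v) ∈ A
  · simp only [indicator_of_mem h, Pi.one_apply, one_mul]
    by_cases h0 : ρ.fst {θ} = 0
    · rw [hv θ h0, h0, mul_zero]
    · have hpos : 0 < ρ.fst.real {θ} := ENNReal.toReal_pos h0 (measure_ne_top _ _)
      rw [← ENNReal.ofReal_toReal (measure_ne_top ρ.fst {θ}), ← Measure.real,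
        ← ENNReal.ofReal_mul (div_nonneg measureReal_nonneg measureReal_nonneg),
        div_mul_cancel₀ _ hpos.ne', Measure.real, ENNReal.ofReal_toReal (measure_ne_top _ _)]
  · simp [indicator_of_notMem h]

/-- Each claim contributes `-x log₂ x ≤ 1 / ln 2` at every output, and there are finitely many
claims. Finiteness allows the passage to real integrals and forces the posterior of the true claim
to be positive. -/
lemma lintegral_logLoss_posterior_lt_top :
    ∫⁻ x, logLoss ((claimPosterior ρ x.2).real {x.1}) ∂ρ < ∞ := by
  rw [lintegral_eq_lintegral_posterior ρ
    (g := fun x => logLoss ((claimPosterior ρ x.2).real {x.1}))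
    (measurable_logLoss.comp (measurable_posterior_real ρ))]
  have h : ∀ v, ∑ θ, logLoss ((claimPosterior ρ v).real {θ}) * claimPosterior ρ v {θ}
      ≤ ∑ _θ : 𝒯, ENNReal.ofReal (1 / Real.log 2) := by
    intro v
    refine Finset.sum_le_sum fun θ _ => ?_
    have h1 := logLoss_mul_ofReal (measureReal_mem_Icc (claimPosterior ρ v) {θ})
    rw [Measure.real, ENNReal.ofReal_toReal (measure_ne_top _ _)] at h1
    rw [Measure.real, h1]
    gcongr
    have := Real.negMulLog_le_one_sub_self
      (measureReal_nonneg (μ := claimPosterior ρ v) (s := {θ}))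
    have h2 := measureReal_nonneg (μ := claimPosterior ρ v) (s := {θ})
    rw [Measure.real] at this h2
    linarith
  refine (lintegral_mono h).trans_lt ?_
  simp only [lintegral_const, measure_univ, mul_one]
  exact ENNReal.sum_lt_top.2 fun _ _ => ENNReal.ofReal_lt_top

lemma ae_posterior_pos : ∀ᵐ x ∂ρ, 0 < (claimPosterior ρ x.2).real {x.1} := by
  have h := ae_lt_top (measurable_logLoss.comp (measurable_posterior_real ρ))
    (lintegral_logLoss_posterior_lt_top ρ).ne
  filter_upwards [h] with x hx
  by_contra hn
  simp only [Function.comp, logLoss, if_pos (not_lt.1 hn), lt_self_iff_false] at hx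

/-- The posterior loss falls short of the prior loss by the mutual information. -/
lemma lintegral_logLoss_posterior_add :
    ∫⁻ x, logLoss ((claimPosterior ρ x.2).real {x.1}) ∂ρ + ENNReal.ofReal (mutualInfoBits ρ)
      = ENNReal.ofReal (entropyBits ρ.fst) := by
  have hL := lintegral_logLoss_posterior_lt_top ρ
  have hm := measurable_posterior_real ρ
  have hm1 : Measurable fun x : 𝒯 × 𝒱 => ρ.fst.real {x.1} :=
    (Measurable.of_discrete (f := fun θ => ρ.fst.real {θ})).comp measurable_fst
  have hml : Measurable fun x : 𝒯 × 𝒱 => logLoss ((claimPosterior ρ x.2).real {x.1}) :=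
    measurable_logLoss.comp hm
  have hml1 : Measurable fun x : 𝒯 × 𝒱 => logLoss (ρ.fst.real {x.1}) :=
    measurable_logLoss.comp hm1
  have hl2 := Real.log_pos one_lt_two
  have hH : ∫⁻ x, logLoss (ρ.fst.real {x.1}) ∂ρ = ENNReal.ofReal (entropyBits ρ.fst) := by
    rw [ofReal_entropyBits, Measure.fst, lintegral_map (by fun_prop) measurable_fst]
  have hHfin : ∫⁻ x, logLoss (ρ.fst.real {x.1}) ∂ρ ≠ ∞ := by rw [hH]; exact ENNReal.ofReal_ne_top
  have hpos := ae_posterior_pos ρ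
  have hpos' : ∀ᵐ x ∂ρ, 0 < ρ.fst.real {x.1} := by
    have h := ae_lt_top hml1 hHfin
    filter_upwards [h] with x hx
    by_contra hn
    simp only [logLoss, if_pos (not_lt.1 hn), lt_self_iff_false] at hx
  have hfin1 := integrable_toReal_of_lintegral_ne_top
    hml.aemeasurable hL.ne
  have hfin2 := integrable_toReal_of_lintegral_ne_top
    hml1.aemeasurable hHfin
  -- The logarithm of the density posterior/prior is the prior loss minus the posterior loss, and
  -- both are integrable.
  have hI : mutualInfoBits ρ = ∫ x, (logLoss (ρ.fst.real {x.1})).toReal ∂ρ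
      - ∫ x, (logLoss ((claimPosterior ρ x.2).real {x.1})).toReal ∂ρ := by
    rw [← integral_sub hfin2 hfin1, mutualInfoBits,
      toReal_klDiv_of_eq_withDensity (by fun_prop) (eq_withDensity_posterior ρ), ← integral_div]
    refine integral_congr_ae ?_
    filter_upwards [hpos, hpos'] with x h1 h2
    rw [toReal_logLoss h1 measureReal_le_one, toReal_logLoss h2 measureReal_le_one,
      ENNReal.toReal_ofReal (div_nonneg h1.le h2.le), Real.log_div h1.ne' h2.ne', Real.logb,
      Real.logb]
    ring
  have e1 := integral_toReal hml.aemeasurable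
    (ae_lt_top hml hL.ne)
  have e2 := integral_toReal hml1.aemeasurable
    (ae_lt_top hml1 hHfin)
  rw [e1, e2, hH, ENNReal.toReal_ofReal (entropyBits_nonneg _)] at hI
  have hI0 : 0 ≤ mutualInfoBits ρ := div_nonneg ENNReal.toReal_nonneg hl2.le
  rw [← ENNReal.ofReal_toReal hL.ne, ← ENNReal.ofReal_add ENNReal.toReal_nonneg hI0]
  congr 1
  linarith

end Posterior

/-! The information gain is at least the mutual information per informative verification times the
expected number of informative verifications. -/

/-- Two functions with the same integral in one coordinate have the same integral. -/
lemma lintegral_pi_congr_of_update {ι : Type*} [Fintype ι] [DecidableEq ι] {X : Type*}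
    [MeasurableSpace X] (μ : Measure X) [SigmaFinite μ] (i : ι) {f g : (ι → X) → ℝ≥0∞}
    (hf : Measurable f) (hg : Measurable g)
    (h : ∀ x, ∫⁻ y, f (Function.update x i y) ∂μ = ∫⁻ y, g (Function.update x i y) ∂μ) :
    ∫⁻ x, f x ∂(Measure.pi fun _ => μ) = ∫⁻ x, g x ∂(Measure.pi fun _ => μ) := by
  -- Tonelli with coordinate `i` integrated first: the full integral depends on `f` only through the
  -- inner one.
  have key := fun (f : (ι → X) → ℝ≥0∞) (hf : Measurable f) =>
    lmarginal_erase' (μ := fun _ : ι => μ) f hf (Finset.mem_univ i)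
  rcases isEmpty_or_nonempty (ι → X) with hE | ⟨⟨x0⟩⟩
  · simp [lintegral_of_isEmpty]
  · have e := key f hf
    rw [funext h, ← key g hg, lmarginal_univ, lmarginal_univ] at e
    exact congrFun e x0

lemma measurableSet_mem_selection {X ι : Type*} [Finite ι] [MeasurableSpace X] {sel : X → Finset ι}
    (hsel : ∀ s : Finset ι, MeasurableSet {x | sel x = s}) (i : ι) :
    MeasurableSet {x | i ∈ sel x} := by
  have : {x | i ∈ sel x} = ⋃ s ∈ {s : Finset ι | i ∈ s}, {x | sel x = s} := by
    ext x; simp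
  rw [this]
  exact MeasurableSet.biUnion (Set.to_countable _) fun s _ => hsel s

lemma measurable_sum_selection {𝒵 : Type*} [MeasurableSpace 𝒵] {η : 𝒵 → ℝ}
    {K : ℕ} (hηm : Measurable η) {sel : (Fin K → 𝒵) → Finset (Fin K)}
    (hsel : ∀ s : Finset (Fin K), MeasurableSet {z | sel z = s}) :
    Measurable fun z : Fin K → 𝒵 => ∑ i ∈ sel z, η (z i) := by
  have : (fun z : Fin K → 𝒵 => ∑ i ∈ sel z, η (z i))
      = fun z => ∑ i, if i ∈ sel z then η (z i) else 0 := by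
    ext z; simp
  rw [this]
  exact Finset.measurable_fun_sum _ fun i _ =>
    Measurable.ite (measurableSet_mem_selection hsel i) (by fun_prop) (by fun_prop)

lemma integrable_sum_selection {𝒵 : Type*} [MeasurableSpace 𝒵] {μ : Measure 𝒵}
    [IsProbabilityMeasure μ] {η : 𝒵 → ℝ}
    {K : ℕ} (hηm : Measurable η) {sel : (Fin K → 𝒵) → Finset (Fin K)}
    (hsel : ∀ s : Finset (Fin K), MeasurableSet {z | sel z = s})
    (hae : ∀ᵐ z ∂(Measure.pi fun _ : Fin K => μ), ∀ i, η (z i) ∈ Ioo (0 : ℝ) 1) :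
    Integrable (fun z : Fin K → 𝒵 => ∑ i ∈ sel z, η (z i))
      (Measure.pi fun _ : Fin K => μ) := by
  refine Integrable.of_bound (measurable_sum_selection hηm hsel).aestronglyMeasurable (K : ℝ)
    (hae.mono fun z hz => ?_)
  rw [Real.norm_eq_abs, abs_of_nonneg (Finset.sum_nonneg fun i _ => (hz i).1.le)]
  calc ∑ i ∈ sel z, η (z i) ≤ ∑ i ∈ sel z, (1 : ℝ) := Finset.sum_le_sum fun i _ => (hz i).2.le
    _ = (sel z).card := by simp
    _ ≤ K := by exact_mod_cast (Finset.card_le_univ (sel z)).trans (by simp)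

lemma ae_pi_forall {X : Type*} [MeasurableSpace X] {μ : Measure X} [IsProbabilityMeasure μ]
    {K : ℕ} {P : X → Prop} (h : ∀ᵐ x ∂μ, P x) :
    ∀ᵐ z ∂(Measure.pi fun _ : Fin K => μ), ∀ i, P (z i) :=
  ae_all_iff.2 fun i =>
    (measurePreserving_eval (fun _ : Fin K => μ) i).quasiMeasurePreserving.ae h

section Gain

variable {𝒯 : Type*} [MeasurableSpace 𝒯]
  {𝒱 : Type*} [MeasurableSpace 𝒱] {𝒵 : Type*} [MeasurableSpace 𝒵]
  (prior : Measure 𝒯) (ver : Kernel (𝒯 × Bool) 𝒱)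

lemma verInfo_nonneg : 0 ≤ verInfo prior ver :=
  div_nonneg ENNReal.toReal_nonneg (Real.log_pos one_lt_two).le

variable [IsMarkovKernel ver] {S : Measure (Bool × 𝒵)} {η : 𝒵 → ℝ}

lemma informativeLaw_fst [SFinite prior] : (informativeLaw prior ver).fst = prior := by
  unfold informativeLaw; exact Measure.fst_compProd _ _

variable [IsProbabilityMeasure prior] [IsProbabilityMeasure S]

instance : IsProbabilityMeasure (informativeLaw prior ver) := by
  unfold informativeLaw; infer_instance

instance (S : Measure (Bool × 𝒵)) [IsProbabilityMeasure S] :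
    IsProbabilityMeasure (recordLaw prior ver S) := by
  unfold recordLaw; infer_instance

instance (S : Measure (Bool × 𝒵)) [IsProbabilityMeasure S] (K : ℕ) :
    IsProbabilityMeasure (windowLaw prior ver S K) := by
  unfold windowLaw; infer_instance

lemma recordLaw_map_statistic :
    (recordLaw prior ver S).map (fun r => r.1.2.2) = S.snd := by
  have h : (recordLaw prior ver S).fst = prior.prod S := Measure.fst_compProd _ _
  rw [show (fun r : (𝒯 × Bool × 𝒵) × 𝒱 => r.1.2.2) = Prod.snd ∘ Prod.snd ∘ Prod.fst from rfl,
    ← Measure.map_map measurable_snd (by fun_prop), ← Measure.map_map measurable_snd (by fun_prop),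
    show (recordLaw prior ver S).map Prod.fst = prior.prod S from h,
    show (prior.prod S).map Prod.snd = S from by
      rw [← Measure.snd, Measure.snd_prod]]
  rfl

lemma windowLaw_map_statistic (K : ℕ) :
    (windowLaw prior ver S K).map (fun r i => (r i).1.2.2) = Measure.pi fun _ => S.snd := by
  have h := Measure.pi_map_pi (μ := fun _ : Fin K => recordLaw prior ver S)
    (f := fun _ r => r.1.2.2) (fun i => by fun_prop)
  simp only [recordLaw_map_statistic] at h
  exact h

variable [Fintype 𝒯] [MeasurableSingletonClass 𝒯] [Nonempty 𝒯]

/-- The probability given to each claim after observing `y`: the posterior if `y` is informative,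
else the prior. -/
noncomputable def recordPredictor (y : Unit ⊕ (Bool × 𝒱)) (θ : 𝒯) : ℝ :=
  Sum.elim (fun _ => prior.real {θ})
    (fun x => if x.1 = true then (claimPosterior (informativeLaw prior ver) x.2).real {θ}
      else prior.real {θ}) y

lemma measurable_recordPredictor (θ : 𝒯) :
    Measurable fun y => recordPredictor prior ver y θ := by
  unfold recordPredictor
  refine Measurable.sumElim measurable_const (Measurable.ite
    (measurable_fst (measurableSet_singleton true)) ?_ measurable_const)
  exact ((measurable_posterior_apply _ θ).ennreal_toReal).comp measurable_snd

lemma recordPredictor_mem_Icc (y : Unit ⊕ (Bool × 𝒱)) (θ : 𝒯) :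
    recordPredictor prior ver y θ ∈ Icc (0 : ℝ) 1 := by
  rcases y with _ | ⟨t, v⟩
  · exact measureReal_mem_Icc _ _
  · cases t
    · simp [recordPredictor]
    · simp [recordPredictor]

lemma sum_recordPredictor (y : Unit ⊕ (Bool × 𝒱)) :
    ∑ θ, recordPredictor prior ver y θ = 1 := by
  have h : ∀ ρ : Measure 𝒯, IsProbabilityMeasure ρ → ∑ θ, ρ.real {θ} = 1 := by
    intro ρ _
    rw [sum_measureReal_singleton]
    simp
  rcases y with _ | ⟨t, v⟩
  · exact h _ inferInstance
  · cases t
    · simp [recordPredictor]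
    · simp [recordPredictor]

lemma measurable_logLoss_recordPredictor :
    Measurable fun x : (Unit ⊕ (Bool × 𝒱)) × 𝒯 => logLoss (recordPredictor prior ver x.1 x.2) :=
  measurable_logLoss.comp
    (measurable_from_prod_countable_left fun θ => measurable_recordPredictor prior ver θ)

lemma informativeLaw_entropy :
    ∫⁻ x, logLoss ((claimPosterior (informativeLaw prior ver) x.2).real {x.1})
        ∂(informativeLaw prior ver) + ENNReal.ofReal (verInfo prior ver)
      = ENNReal.ofReal (entropyBits prior) := by
  have h := lintegral_logLoss_posterior_add (informativeLaw prior ver)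
  rwa [informativeLaw_fst] at h

/-- This keeps `H - η * I_ver` nonnegative for scores in the unit interval, so that `ENNReal.ofReal`
never truncates it. -/
lemma verInfo_le_entropyBits : verInfo prior ver ≤ entropyBits prior := by
  rw [← ENNReal.ofReal_le_ofReal_iff (entropyBits_nonneg prior),
    ← informativeLaw_entropy prior ver]
  exact le_add_self

/-- The expected loss on one record, if it is verified exactly when its statistic is in `C`. -/
lemma lintegral_recordLaw (hη : IsBayesScore S η) (h01 : ∀ᵐ z ∂S.snd, η z ∈ Ioo (0 : ℝ) 1)
    {C : Set 𝒵} [DecidablePred (· ∈ C)] (hC : MeasurableSet C) :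
    ∫⁻ r, logLoss (recordPredictor prior ver
      (if r.1.2.2 ∈ C then Sum.inr (r.1.2.1, r.2) else Sum.inl ()) r.1.1) ∂(recordLaw prior ver S)
    = ∫⁻ z, (if z ∈ C then ENNReal.ofReal (entropyBits prior - η z * verInfo prior ver)
      else ENNReal.ofReal (entropyBits prior)) ∂S.snd := by
  have hη' := hη.1
  have hI0 := verInfo_nonneg prior ver
  have hH0 := entropyBits_nonneg prior
  have hIH := verInfo_le_entropyBits prior ver
  have hm1 := measurable_logLoss_recordPredictor prior ver
  have hF : Measurable fun r : (𝒯 × Bool × 𝒵) × 𝒱 => logLoss (recordPredictor prior ver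
      (if r.1.2.2 ∈ C then Sum.inr (r.1.2.1, r.2) else Sum.inl ()) r.1.1) := by
    refine hm1.comp (Measurable.prodMk ?_ (by fun_prop))
    exact Measurable.ite (hC.preimage (f := fun r : (𝒯 × Bool × 𝒵) × 𝒱 => r.1.2.2) (by fun_prop))
      (by fun_prop) (by fun_prop)
  -- With type and statistic fixed, the claim still has its prior law. Only a verified record with
  -- `T = 1` gains, by `informativeLaw_entropy`; in all other cases the predictor is the prior and
  -- its loss is `H`.
  have e : ∀ x : Bool × 𝒵, ∫⁻ θ, ∫⁻ v, logLoss (recordPredictor prior ver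
      (if x.2 ∈ C then Sum.inr (x.1, v) else Sum.inl ()) θ) ∂(ver (θ, x.1)) ∂prior
      = if x.2 ∈ C ∧ x.1 = true then ENNReal.ofReal (entropyBits prior - verInfo prior ver)
        else ENNReal.ofReal (entropyBits prior) := by
    rintro ⟨t, z⟩
    by_cases hz : z ∈ C
    · cases t
      · simp [hz, recordPredictor, ofReal_entropyBits]
      · simp only [hz, if_true, and_self, recordPredictor, Sum.elim_inr]
        rw [ENNReal.ofReal_sub _ hI0]
        refine ENNReal.eq_sub_of_add_eq ENNReal.ofReal_ne_top ?_
        rw [← informativeLaw_entropy prior ver]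
        congr 1
        exact (Measure.lintegral_compProd (μ := prior)
          (κ := ver.comap (fun θ => (θ, true)) (by fun_prop))
          (measurable_logLoss.comp (measurable_posterior_real (informativeLaw prior ver)))).symm
    · simp [hz, recordPredictor, ofReal_entropyBits]
  rw [recordLaw, Measure.lintegral_compProd hF, lintegral_prod_symm]
  swap
  · exact (hF.lintegral_kernel_prod_right' (κ := ver.comap (fun x : 𝒯 × Bool × 𝒵 => (x.1, x.2.1))
      (by fun_prop))).aemeasurable
  simp only [Kernel.comap_apply, e]
  have hmE : Measurable fun x : Bool × 𝒵 => if x.2 ∈ C ∧ x.1 = true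
      then ENNReal.ofReal (entropyBits prior - verInfo prior ver)
      else ENNReal.ofReal (entropyBits prior) :=
    Measurable.ite ((hC.preimage measurable_snd).inter
      (measurable_fst (measurableSet_singleton true))) measurable_const measurable_const
  rw [lintegral_eq_lintegral_score hη h01 hmE]
  refine lintegral_congr_ae (h01.mono fun z hz => ?_)
  have hz1 : 0 ≤ 1 - η z := by linarith [hz.2]
  by_cases h : z ∈ C
  · simp only [h, and_self, if_true, true_and, Bool.false_eq_true, if_false]
    rw [← ENNReal.ofReal_mul hz.1.le, ← ENNReal.ofReal_mul hz1,
      ← ENNReal.ofReal_add (mul_nonneg hz.1.le (by linarith)) (mul_nonneg hz1 hH0)]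
    congr 1
    ring
  · simp only [h, false_and, if_false]
    rw [← ENNReal.ofReal_mul hz.1.le, ← ENNReal.ofReal_mul hz1,
      ← ENNReal.ofReal_add (mul_nonneg hz.1.le hH0) (mul_nonneg hz1 hH0)]
    congr 1
    ring

/-- The bound on the expected loss by the predictor that treats the records separately. -/
lemma bayesLogLoss_le {K : ℕ} (sel : (Fin K → 𝒵) → Finset (Fin K))
    (hsel : ∀ s : Finset (Fin K), MeasurableSet {z | sel z = s})
    (hη : IsBayesScore S η) (h01 : ∀ᵐ z ∂S.snd, η z ∈ Ioo (0 : ℝ) 1) :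
    bayesLogLoss prior ver S sel ≤ ∑ i, ∫⁻ z,
      (if i ∈ sel z then ENNReal.ofReal (entropyBits prior - η (z i) * verInfo prior ver)
      else ENNReal.ofReal (entropyBits prior)) ∂(Measure.pi fun _ : Fin K => S.snd) := by
  classical
  have hmem := measurableSet_mem_selection hsel
  have hη' := hη.1
  let q : Observation 𝒵 𝒱 K → (Fin K → 𝒯) → ℝ := fun y θ =>
    ∏ i, recordPredictor prior ver (y.2 i) (θ i)
  have hqm : Measurable q := by
    refine measurable_pi_iff.2 fun θ => Finset.measurable_fun_prod _ fun i _ => ?_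
    exact (measurable_recordPredictor prior ver (θ i)).comp (by fun_prop)
  have hqs : ∀ y, q y ∈ stdSimplex ℝ (Fin K → 𝒯) := by
    intro y
    refine ⟨fun θ => Finset.prod_nonneg fun i _ => (recordPredictor_mem_Icc _ _ _ _).1, ?_⟩
    have h := Finset.prod_univ_sum (fun _ : Fin K => (Finset.univ : Finset 𝒯))
      (fun i θ => recordPredictor prior ver (y.2 i) θ)
    simp only [sum_recordPredictor, Finset.prod_const_one, Fintype.piFinset_univ] at h
    exact h.symm
  refine (iInf₂_le q ⟨hqm, hqs⟩).trans ?_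
  have hm1 := measurable_logLoss_recordPredictor prior ver
  have hm2 : ∀ i : Fin K, Measurable fun r : Fin K → (𝒯 × Bool × 𝒵) × 𝒱 =>
      logLoss (recordPredictor prior ver ((observe sel r).2 i) (r i).1.1) := by
    intro i
    refine hm1.comp (Measurable.prodMk ?_ (by fun_prop))
    refine Measurable.ite ?_ (by fun_prop) (by fun_prop)
    exact (hmem i).preimage (f := fun (r : Fin K → (𝒯 × Bool × 𝒵) × 𝒱) j => (r j).1.2.2)
      (by fun_prop)
  simp only [q, logLoss_prod _ fun i => recordPredictor_mem_Icc prior ver _ _]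
  rw [lintegral_finsetSum _ fun i _ => hm2 i]
  refine Finset.sum_le_sum fun i _ => le_of_eq ?_
  have hm3 : Measurable fun z : Fin K → 𝒵 =>
      (if i ∈ sel z then ENNReal.ofReal (entropyBits prior - η (z i) * verInfo prior ver)
      else ENNReal.ofReal (entropyBits prior)) :=
    Measurable.ite (hmem i) (by fun_prop) (by fun_prop)
  rw [← windowLaw_map_statistic prior ver K, lintegral_map hm3 (by fun_prop)]
  -- With the other records frozen at `r`, record `i` is selected exactly when its own statistic
  -- lies in the set of `hC`, so the computation for one record applies.
  refine lintegral_pi_congr_of_update _ i (hm2 i) (hm3.comp (by fun_prop)) fun r => ?_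
  have hC : MeasurableSet {z : 𝒵 | i ∈ sel (Function.update (fun j => (r j).1.2.2) i z)} :=
    (hmem i).preimage (measurable_update _)
  have hu : ∀ y : (𝒯 × Bool × 𝒵) × 𝒱, (fun j => (Function.update r i y j).1.2.2)
      = Function.update (fun j => (r j).1.2.2) i y.1.2.2 := by
    intro y; ext j
    by_cases h : j = i
    · subst h; simp
    · simp [h]
  have h := lintegral_recordLaw prior ver hη h01 hC
  simp only [observe, hu, Function.update_self]
  have hmC : Measurable fun z => if i ∈ sel (Function.update (fun j => (r j).1.2.2) i z)
      then ENNReal.ofReal (entropyBits prior - η z * verInfo prior ver)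
      else ENNReal.ofReal (entropyBits prior) :=
    Measurable.ite hC (by fun_prop) (by fun_prop)
  simp only [mem_ofPred_eq] at h
  rw [← recordLaw_map_statistic prior ver, lintegral_map hmC (by fun_prop)] at h
  exact h

/-- The gain is at least the expected number of informative verifications times the information
that each of them gives. -/
lemma verInfo_mul_le_gain {K : ℕ} (sel : (Fin K → 𝒵) → Finset (Fin K))
    (hsel : ∀ s : Finset (Fin K), MeasurableSet {z | sel z = s})
    (hη : IsBayesScore S η) (h01 : ∀ᵐ z ∂S.snd, η z ∈ Ioo (0 : ℝ) 1) :
    verInfo prior ver * ∫ z, ∑ i ∈ sel z, η (z i) ∂(Measure.pi fun _ : Fin K => S.snd)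
      ≤ gain prior ver S sel := by
  classical
  have hη' := hη.1
  have hmem := measurableSet_mem_selection hsel
  have hI0 := verInfo_nonneg prior ver
  have hH0 := entropyBits_nonneg prior
  have hIH := verInfo_le_entropyBits prior ver
  set H := entropyBits prior
  set I := verInfo prior ver
  have hae := ae_pi_forall (K := K) h01
  have hle := bayesLogLoss_le prior ver sel hsel hη h01
  have hint := integrable_sum_selection hη' hsel hae
  -- Nonnegativity is part of the claim because the extended-valued bound is then turned into a real
  -- integral.
  have hpt : ∀ᵐ z ∂(Measure.pi fun _ : Fin K => S.snd),
      ∑ i, (if i ∈ sel z then ENNReal.ofReal (H - η (z i) * I) else ENNReal.ofReal H)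
        = ENNReal.ofReal (K * H - I * ∑ i ∈ sel z, η (z i)) ∧
      0 ≤ K * H - I * ∑ i ∈ sel z, η (z i) := by
    refine hae.mono fun z hz => ?_
    have h1 : ∀ i, 0 ≤ if i ∈ sel z then H - η (z i) * I else H := by
      intro i
      split_ifs
      · nlinarith [(hz i).1, (hz i).2]
      · exact hH0
    have h2 : ∑ i, (if i ∈ sel z then H - η (z i) * I else H)
        = K * H - I * ∑ i ∈ sel z, η (z i) := by
      have : ∀ i, (if i ∈ sel z then H - η (z i) * I else H)
          = H - if i ∈ sel z then I * η (z i) else 0 := by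
        intro i; split_ifs <;> ring
      simp only [this, Finset.sum_sub_distrib, Finset.sum_ite_mem, Finset.univ_inter,
        Finset.mul_sum]
      simp
    refine ⟨?_, h2 ▸ Finset.sum_nonneg fun i _ => h1 i⟩
    rw [← h2, ENNReal.ofReal_sum_of_nonneg fun i _ => h1 i]
    exact Finset.sum_congr rfl fun i _ => by split_ifs <;> rfl
  have hint2 : Integrable (fun z : Fin K → 𝒵 => K * H - I * ∑ i ∈ sel z, η (z i))
      (Measure.pi fun _ : Fin K => S.snd) := (integrable_const _).sub (hint.const_mul I)
  rw [← lintegral_finsetSum _ fun i _ => Measurable.ite (hmem i) (by fun_prop) (by fun_prop),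
    lintegral_congr_ae (hpt.mono fun z hz => hz.1),
    ← ofReal_integral_eq_lintegral_ofReal hint2 (hpt.mono fun z hz => hz.2),
    integral_sub (integrable_const _) (hint.const_mul I), integral_const_mul] at hle
  have hnn : 0 ≤ ∫ z : Fin K → 𝒵, (K * H - I * ∑ i ∈ sel z, η (z i))
      ∂(Measure.pi fun _ : Fin K => S.snd) := integral_nonneg_of_ae (hpt.mono fun z hz => hz.2)
  rw [integral_sub (integrable_const _) (hint.const_mul I), integral_const_mul] at hnn
  have hD := ENNReal.toReal_le_of_le_ofReal hnn hle
  have hc : claimEntropy prior K = K * H := by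
    have h := ofReal_claimEntropy prior K
    rw [← ENNReal.ofReal_natCast, ← ENNReal.ofReal_mul (Nat.cast_nonneg K)] at h
    exact (ENNReal.ofReal_eq_ofReal_iff (entropyBits_nonneg _)
      (mul_nonneg (Nat.cast_nonneg K) hH0)).1 h
  rw [gain, hc]
  simp only [integral_const, probReal_univ, one_smul] at hD
  rw [integral_const_mul] at hD
  linarith

end Gain

/-! Selecting the largest scores. -/

/-- Exchange argument: `t \ s` and `s \ t` have equally many elements, and the least value on `s \
t` separates them. -/
lemma sum_le_sum_of_forall_le {ι : Type*} [DecidableEq ι] {s t : Finset ι} {h : ι → ℝ}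
    (hst : t.card = s.card) (hs : ∀ i ∈ s, ∀ j ∉ s, h j ≤ h i) :
    ∑ i ∈ t, h i ≤ ∑ i ∈ s, h i := by
  have hc : (t \ s).card = (s \ t).card := by
    have h1 := Finset.card_sdiff_add_card_inter t s
    have h2 := Finset.card_sdiff_add_card_inter s t
    rw [Finset.inter_comm] at h2
    omega
  rw [← Finset.sum_sdiff_le_sum_sdiff]
  rcases (s \ t).eq_empty_or_nonempty with he | hne
  · rw [he, Finset.card_empty, Finset.card_eq_zero] at hc
    rw [he, hc]
  · obtain ⟨i, hi, hmin⟩ := Finset.exists_min_image (s \ t) h hne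
    calc ∑ j ∈ t \ s, h j ≤ (t \ s).card • h i :=
          Finset.sum_le_card_nsmul _ _ _ fun j hj =>
            hs i (Finset.mem_sdiff.1 hi).1 j (Finset.mem_sdiff.1 hj).2
      _ = (s \ t).card • h i := by rw [hc]
      _ ≤ _ := Finset.card_nsmul_le_sum _ _ _ hmin

/-- Correcting the size of `A` changes `|#A - B|` indices, and each costs `|x| ≤ τ x² / 2 + 1 / (2
τ)`. This inequality replaces a truncation of `g`: the squares have bounded mean, and the size
defect is small against `K`. -/
lemma exists_card_eq_sum_ge {ι : Type*} [Fintype ι] [DecidableEq ι] (A : Finset ι) {B : ℕ}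
    (hB : B ≤ Fintype.card ι) (g : ι → ℝ) {τ : ℝ} (hτ : 0 < τ) :
    ∃ t : Finset ι, t.card = B ∧
      ∑ i ∈ A, g i - τ / 2 * ∑ i, g i ^ 2 - |(A.card : ℝ) - B| / (2 * τ) ≤ ∑ i ∈ t, g i := by
  have hg : ∀ x : ℝ, |x| ≤ τ / 2 * x ^ 2 + 1 / (2 * τ) := by
    intro x
    have h : 0 ≤ (τ * |x| - 1) ^ 2 / (2 * τ) := by positivity
    have e : (τ * |x| - 1) ^ 2 / (2 * τ) = τ / 2 * x ^ 2 + 1 / (2 * τ) - |x| := by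
      rw [← sq_abs x]; field_simp; ring
    linarith
  have hd : ∀ D : Finset ι, ∑ i ∈ D, |g i| ≤ τ / 2 * ∑ i, g i ^ 2 + D.card / (2 * τ) := by
    intro D
    calc ∑ i ∈ D, |g i| ≤ ∑ i ∈ D, (τ / 2 * g i ^ 2 + 1 / (2 * τ)) :=
          Finset.sum_le_sum fun i _ => hg _
      _ = τ / 2 * ∑ i ∈ D, g i ^ 2 + D.card / (2 * τ) := by
          rw [Finset.sum_add_distrib, Finset.mul_sum, Finset.sum_const, nsmul_eq_mul]; ring
      _ ≤ _ := by
          gcongr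
          exact Finset.subset_univ _
  rcases le_total B A.card with h | h
  · obtain ⟨t, htA, ht⟩ := Finset.exists_subset_card_eq h
    refine ⟨t, ht, ?_⟩
    have h1 := Finset.sum_sdiff (f := g) htA
    have h2 := hd (A \ t)
    have h3 := (le_abs_self _).trans (Finset.abs_sum_le_sum_abs g (A \ t))
    have h4 : ((A \ t).card : ℝ) = |(A.card : ℝ) - B| := by
      rw [Finset.card_sdiff_of_subset htA, ht, Nat.cast_sub h, abs_of_nonneg]
      exact sub_nonneg.2 (by exact_mod_cast h)
    rw [h4] at h2
    linarith
  · obtain ⟨t, htA, ht⟩ := Finset.exists_superset_card_eq h hB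
    refine ⟨t, ht, ?_⟩
    have h1 := Finset.sum_sdiff (f := g) htA
    have h2 := hd (t \ A)
    have h3 := (neg_abs_le _).trans' (neg_le_neg (Finset.abs_sum_le_sum_abs g (t \ A)))
    have h4 : ((t \ A).card : ℝ) = |(A.card : ℝ) - B| := by
      rw [Finset.card_sdiff_of_subset htA, ht, Nat.cast_sub h, abs_of_nonpos, neg_sub]
      exact sub_nonpos.2 (by exact_mod_cast h)
    rw [h4] at h2
    linarith

/-- The lower bound for the sum of the largest scores in terms of the standardized scores. -/
lemma sum_top_ge {ι : Type*} [Fintype ι] [DecidableEq ι] (A : Finset ι) {s : Finset ι}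
    {h g : ι → ℝ} {p v ε τ : ℝ} (hv : 0 ≤ v) (hε : 0 ≤ ε) (hτ : 0 < τ)
    (hs : ∀ i ∈ s, ∀ j ∉ s, h j ≤ h i) (hh : ∀ i, p + v * (ε * g i) - (ε * g i) ^ 2 ≤ h i) :
    s.card * p + v * ε * (∑ i ∈ A, g i - τ / 2 * ∑ i, g i ^ 2
      - |(A.card : ℝ) - s.card| / (2 * τ)) - ε ^ 2 * ∑ i, g i ^ 2 ≤ ∑ i ∈ s, h i := by
  obtain ⟨t, ht, htg⟩ := exists_card_eq_sum_ge A (Finset.card_le_univ s) g hτ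
  refine le_trans ?_ (sum_le_sum_of_forall_le ht hs)
  refine le_trans ?_ (Finset.sum_le_sum fun i (_ : i ∈ t) => hh i)
  have e : ∑ i ∈ t, (p + v * (ε * g i) - (ε * g i) ^ 2)
      = s.card * p + v * ε * ∑ i ∈ t, g i - ε ^ 2 * ∑ i ∈ t, g i ^ 2 := by
    rw [Finset.sum_sub_distrib, Finset.sum_add_distrib, Finset.sum_const, ht, nsmul_eq_mul,
      Finset.mul_sum, Finset.mul_sum]
    congr 1
    · congr 1
      exact Finset.sum_congr rfl fun i _ => by ring
    · exact Finset.sum_congr rfl fun i _ => by ring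
  rw [e]
  have h1 : ∑ i ∈ t, g i ^ 2 ≤ ∑ i, g i ^ 2 :=
    Finset.sum_le_sum_of_subset_of_nonneg (Finset.subset_univ _) fun i _ _ => sq_nonneg _
  have h2 := mul_le_mul_of_nonneg_left htg (mul_nonneg hv hε)
  have h3 := mul_le_mul_of_nonneg_left h1 (sq_nonneg ε)
  linarith

/-! The upper tail of an atomless law. -/

section Tail

variable (ν : Measure ℝ)

/-- For `q ≤ 0` the part below `q` contributes a nonpositive amount to a total of zero. The
resulting sign of `m_G` is needed when an upper bound on `J` is multiplied by it. -/
lemma setIntegral_Ici_nonneg (hint : Integrable (fun g : ℝ => g) ν) (h : ∫ g, g ∂ν = 0) (q : ℝ) :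
    0 ≤ ∫ g in Ici q, g ∂ν := by
  rcases le_total 0 q with hq | hq
  · exact setIntegral_nonneg measurableSet_Ici fun g hg => hq.trans hg
  · have h1 := integral_add_compl (measurableSet_Ici (a := q)) hint
    have h2 : ∫ g in (Ici q)ᶜ, g ∂ν ≤ 0 := by
      refine setIntegral_nonpos measurableSet_Ici.compl fun g hg => ?_
      rw [compl_Ici] at hg
      exact (le_of_lt hg).trans hq
    linarith

lemma tailMean_nonneg (hint : Integrable (fun g : ℝ => g) ν) (h : ∫ g, g ∂ν = 0) {α : ℝ}
    (hα : 0 < α) : 0 ≤ tailMean ν α :=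
  mul_nonneg (by positivity) (setIntegral_Ici_nonneg ν hint h _)

variable [IsProbabilityMeasure ν]

/-- At the quantile the distribution function is at least `1 - α` by right continuity and its left
limit is at most `1 - α`. Without an atom the two agree. -/
lemma measureReal_Ici_upperQuantile [NullSingletonClass ν] {α : ℝ} (hα : α ∈ Ioo (0 : ℝ) 1) :
    ν.real (Ici (upperQuantile ν α)) = α := by
  set q := upperQuantile ν α with hq
  have hF : ∀ x, ν.real (Iic x) = cdf ν x := fun x => (cdf_eq_real ν x).symm
  have hset : {x : ℝ | 1 - α ≤ ν.real (Iic x)} = {x | 1 - α ≤ cdf ν x} := by simp only [hF]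
  rw [upperQuantile, hset] at hq
  have hne : {x | 1 - α ≤ cdf ν x}.Nonempty := by
    obtain ⟨x, hx⟩ := ((tendsto_cdf_atTop ν).eventually
      (eventually_ge_nhds (show 1 - α < 1 by linarith [hα.1]))).exists
    exact ⟨x, hx⟩
  have hbdd : BddBelow {x | 1 - α ≤ cdf ν x} := by
    obtain ⟨x, hx⟩ := ((tendsto_cdf_atBot ν).eventually
      (eventually_lt_nhds (show 0 < 1 - α by linarith [hα.2]))).exists
    refine ⟨x, fun y hy => ?_⟩
    by_contra! hlt
    exact (hx.trans_le hy).not_ge (monotone_cdf ν hlt.le)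
  have hright : 1 - α ≤ cdf ν q := by
    have hc : Filter.Tendsto (cdf ν) (nhdsWithin q (Ioi q)) (nhds (cdf ν q)) :=
      ((cdf ν).right_continuous q).mono Ioi_subset_Ici_self
    refine ge_of_tendsto hc (eventually_nhdsWithin_of_forall fun x hx => ?_)
    obtain ⟨y, hy, hyx⟩ := exists_lt_of_csInf_lt hne (hq ▸ hx)
    exact hy.trans (monotone_cdf ν hyx.le)
  have hleft : Function.leftLim (cdf ν) q ≤ 1 - α := by
    refine le_of_tendsto ((monotone_cdf ν).tendsto_leftLim q)
      (eventually_nhdsWithin_of_forall fun x hx => ?_)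
    by_contra! hlt
    exact (csInf_le hbdd (show x ∈ {x | 1 - α ≤ cdf ν x} from hlt.le)).not_gt (hq ▸ hx)
  have hatom : Function.leftLim (cdf ν) q = cdf ν q := by
    have h1 := (cdf ν).measure_singleton q
    rw [measure_cdf, measure_singleton] at h1
    have h2 := ENNReal.ofReal_eq_zero.1 h1.symm
    exact le_antisymm ((monotone_cdf ν).leftLim_le le_rfl) (by linarith)
  have hq1 : ν.real (Iic q) = 1 - α := by
    rw [hF]; linarith
  have h3 : ν.real (Ici q) = ν.real (Ioi q) := measureReal_congr Ioi_ae_eq_Ici.symm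
  rw [h3, ← compl_Iic, probReal_compl_eq_one_sub measurableSet_Iic, hq1]
  ring

lemma integrable_id_of_integrable_sq (h : Integrable (fun g : ℝ => g ^ 2) ν) :
    Integrable (fun g : ℝ => g) ν := by
  refine ((integrable_const (1 : ℝ)).add h).mono' (by fun_prop) (ae_of_all _ fun g => ?_)
  simp only [Pi.add_apply, Real.norm_eq_abs]
  rw [abs_le]
  constructor <;> nlinarith [sq_nonneg (g - 1), sq_nonneg (g + 1)]

/-- A lower bound for the expected sum of the largest standardized scores. -/
lemma le_integral_tail [NullSingletonClass ν] (hG2i : Integrable (fun g : ℝ => g ^ 2) ν)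
    (hG2 : ∫ g, g ^ 2 ∂ν = 1) {α : ℝ} (hα : α ∈ Ioo (0 : ℝ) 1) {K B : ℕ} (hK : 0 < K)
    (hB1 : (B : ℝ) ≤ α * K) (hB2 : α * K < B + 1) {τ : ℝ} (hτ : 0 < τ)
    (hKτ : (1 / (2 * τ ^ 2) + 1) / (2 * τ) ≤ τ / 4 * K) {A : (Fin K → ℝ) → Finset (Fin K)}
    (hA : ∀ g i, i ∈ A g ↔ upperQuantile ν α ≤ g i) :
    Integrable (fun g : Fin K → ℝ => ∑ i, g i ^ 2) (Measure.pi fun _ => ν) ∧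
    ∫ g : Fin K → ℝ, ∑ i, g i ^ 2 ∂(Measure.pi fun _ => ν) = K ∧
    Integrable (fun g : Fin K → ℝ => ∑ i ∈ A g, g i - τ / 2 * ∑ i, g i ^ 2
      - |((A g).card : ℝ) - B| / (2 * τ)) (Measure.pi fun _ => ν) ∧
    K * (α * tailMean ν α - τ) ≤ ∫ g : Fin K → ℝ, (∑ i ∈ A g, g i - τ / 2 * ∑ i, g i ^ 2
      - |((A g).card : ℝ) - B| / (2 * τ)) ∂(Measure.pi fun _ => ν) := by
  set q := upperQuantile ν α with hq
  have hG1i := integrable_id_of_integrable_sq ν hG2i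
  have hK' : (0 : ℝ) < K := by exact_mod_cast hK
  have heval : ∀ f : ℝ → ℝ, Integrable f ν →
      Integrable (fun g : Fin K → ℝ => ∑ i, f (g i)) (Measure.pi fun _ => ν) ∧
      ∫ g : Fin K → ℝ, ∑ i, f (g i) ∂(Measure.pi fun _ => ν) = K * ∫ x, f x ∂ν := by
    intro f hf
    have h1 : ∀ i : Fin K, Integrable (fun g : Fin K → ℝ => f (g i)) (Measure.pi fun _ => ν) :=
      fun i => (measurePreserving_eval (fun _ : Fin K => ν) i).integrable_comp_of_integrable hf
    refine ⟨integrable_finsetSum _ fun i _ => h1 i, ?_⟩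
    rw [integral_finsetSum _ fun i _ => h1 i]
    have h2 : ∀ i : Fin K, ∫ g : Fin K → ℝ, f (g i) ∂(Measure.pi fun _ => ν) = ∫ x, f x ∂ν := by
      intro i
      have hmp := measurePreserving_eval (fun _ : Fin K => ν) i
      have h3 := integral_map (μ := Measure.pi fun _ : Fin K => ν) (φ := Function.eval i)
        (f := f) hmp.measurable.aemeasurable (by rw [hmp.map_eq]; exact hf.aestronglyMeasurable)
      rw [hmp.map_eq] at h3
      exact h3.symm
    simp [h2]
  have hmemA : ∀ g, A g = Finset.univ.filter fun i => q ≤ g i := by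
    intro g; ext i; simp [hA]
  have hsum : ∀ g, ∑ i ∈ A g, g i = ∑ i, (Ici q).indicator (fun x => x) (g i) := by
    intro g
    rw [hmemA, Finset.sum_filter]
    rfl
  have hcard : ∀ g, ((A g).card : ℝ) = ∑ i, (Ici q).indicator (fun _ => (1 : ℝ)) (g i) := by
    intro g
    rw [hmemA, Finset.card_filter, Nat.cast_sum]
    refine Finset.sum_congr rfl fun i _ => ?_
    by_cases h : q ≤ g i
    · simp [h]
    · simp [h]
  obtain ⟨i1, e1⟩ := heval _ hG2i
  obtain ⟨i2, e2⟩ := heval _ (hG1i.indicator measurableSet_Ici (s := Ici q))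
  rw [hG2, mul_one] at e1
  rw [integral_indicator measurableSet_Ici] at e2
  have hα1 := hα.1.ne'
  have e3 : ∫ g in Ici q, g ∂ν = α * tailMean ν α := by
    rw [tailMean, ← hq]; field_simp
  rw [e3] at e2
  have hind : MemLp ((Ici q).indicator fun _ => (1 : ℝ)) 2 ν :=
    memLp_indicator_const _ measurableSet_Ici _ (Or.inr (measure_ne_top _ _))
  have hNi := heval _ (hind.integrable one_le_two)
  have hmean : ∫ x, (Ici q).indicator (fun _ => (1 : ℝ)) x ∂ν = α := by
    rw [integral_indicator measurableSet_Ici, setIntegral_const, hq,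
      measureReal_Ici_upperQuantile ν hα, smul_eq_mul, mul_one]
  rw [hmean] at hNi
  have hNL : MemLp (fun g : Fin K → ℝ => ((A g).card : ℝ)) 2 (Measure.pi fun _ => ν) := by
    simp only [hcard]
    exact memLp_finsetSum _ fun i _ =>
      hind.comp_measurePreserving (measurePreserving_eval (fun _ : Fin K => ν) i)
  have hNmean : ∫ g : Fin K → ℝ, ((A g).card : ℝ) ∂(Measure.pi fun _ => ν) = K * α := by
    simp only [hcard]; exact hNi.2
  -- The number of exceedances is a sum of independent indicators, each of variance at most 1.
  have hvar : ∫ g : Fin K → ℝ, (((A g).card : ℝ) - α * K) ^ 2 ∂(Measure.pi fun _ => ν) ≤ K := by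
    have h1 := variance_eq_integral hNL.aestronglyMeasurable.aemeasurable
    rw [hNmean] at h1
    have h2 := variance_sum_pi (μ := fun _ : Fin K => ν)
      (X := fun _ => (Ici q).indicator fun _ => (1 : ℝ)) fun _ => hind
    have h3 : (∑ i : Fin K, fun ω : Fin K → ℝ => (Ici q).indicator (fun _ => (1 : ℝ)) (ω i))
        = fun g => ((A g).card : ℝ) := by
      ext g; simp [hcard]
    rw [h3, h1] at h2
    have h4 : Var[(Ici q).indicator (fun _ => (1 : ℝ)); ν] ≤ 1 := by
      refine (variance_le_expectation_sq hind.aestronglyMeasurable).trans ?_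
      have : ∀ x : ℝ, ((Ici q).indicator (fun _ => (1 : ℝ)) ^ 2) x
          = (Ici q).indicator (fun _ => (1 : ℝ)) x := by
        intro x
        by_cases h : x ∈ Ici q <;> simp [h, -mem_Ici]
      simp only [this, hmean]
      exact hα.2.le
    simp only [mul_comm α]
    rw [h2, Finset.sum_const, Finset.card_univ, Fintype.card_fin, nsmul_eq_mul]
    nlinarith
  have hsqi : Integrable (fun g : Fin K → ℝ => (((A g).card : ℝ) - α * K) ^ 2)
      (Measure.pi fun _ => ν) := (hNL.sub (memLp_const _)).integrable_sq
  have habsi : Integrable (fun g : Fin K → ℝ => |((A g).card : ℝ) - B|)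
      (Measure.pi fun _ => ν) :=
    ((hNL.integrable one_le_two).sub (integrable_const _)).abs
  -- Young's inequality at scale `τ² K` makes the mean deviation at most `τ² K / 2` plus a constant;
  -- the summand 1 pays for rounding `α K` down to `B`.
  have hb : ∀ g, |((A g).card : ℝ) - B|
      ≤ 1 + τ ^ 2 * K / 2 + (((A g).card : ℝ) - α * K) ^ 2 / (2 * τ ^ 2 * K) := by
    intro g
    set y := ((A g).card : ℝ) - α * K with hy
    have h1 : |((A g).card : ℝ) - B| ≤ |y| + 1 := by
      have : ((A g).card : ℝ) - B = y + (α * K - B) := by rw [hy]; ring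
      rw [this]
      refine (abs_add_le _ _).trans ?_
      gcongr
      rw [abs_le]; constructor <;> linarith
    have h2 : 0 ≤ (|y| - τ ^ 2 * K) ^ 2 / (2 * τ ^ 2 * K) := by positivity
    have h3 : (|y| - τ ^ 2 * K) ^ 2 / (2 * τ ^ 2 * K)
        = y ^ 2 / (2 * τ ^ 2 * K) - |y| + τ ^ 2 * K / 2 := by
      rw [← sq_abs y]; field_simp; ring
    linarith
  have habs : ∫ g : Fin K → ℝ, |((A g).card : ℝ) - B| ∂(Measure.pi fun _ => ν)
      ≤ 1 + τ ^ 2 * K / 2 + 1 / (2 * τ ^ 2) := by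
    have hdi := hsqi.div_const (2 * τ ^ 2 * K)
    calc _ ≤ ∫ g : Fin K → ℝ, (1 + τ ^ 2 * K / 2
          + (((A g).card : ℝ) - α * K) ^ 2 / (2 * τ ^ 2 * K)) ∂(Measure.pi fun _ => ν) :=
          integral_mono habsi ((integrable_const _).add hdi) hb
      _ = 1 + τ ^ 2 * K / 2 + (∫ g : Fin K → ℝ, (((A g).card : ℝ) - α * K) ^ 2
            ∂(Measure.pi fun _ => ν)) / (2 * τ ^ 2 * K) := by
          rw [integral_add (integrable_const _) hdi, integral_div]; simp
      _ ≤ 1 + τ ^ 2 * K / 2 + K / (2 * τ ^ 2 * K) := by gcongr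
      _ = _ := by field_simp
  simp only [hsum]
  have i3 := i1.const_mul (τ / 2)
  have i4 := habsi.div_const (2 * τ)
  have i5 : Integrable (fun g : Fin K → ℝ => ∑ i, (Ici q).indicator (fun x => x) (g i)
      - τ / 2 * ∑ i, g i ^ 2) (Measure.pi fun _ => ν) := i2.sub i3
  refine ⟨i1, e1, i5.sub i4, ?_⟩
  rw [integral_sub i5 i4, integral_sub i2 i3, e2, integral_const_mul, e1, integral_div]
  have h1 : (∫ g : Fin K → ℝ, |((A g).card : ℝ) - B| ∂(Measure.pi fun _ => ν)) / (2 * τ)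
      ≤ (1 + τ ^ 2 * K / 2 + 1 / (2 * τ ^ 2)) / (2 * τ) := by gcongr
  -- The error budget `τ K` is spent as `τ K / 2` on the squares, `τ K / 4` on the deviation, and `τ
  -- K / 4` on the constants, by `hKτ`.
  have h2 : (1 + τ ^ 2 * K / 2 + 1 / (2 * τ ^ 2)) / (2 * τ)
      = τ / 4 * K + (1 / (2 * τ ^ 2) + 1) / (2 * τ) := by
    field_simp; ring
  nlinarith

end Tail

/-! Weak screening. -/

section WeakScreening

variable {𝒵 : Type*} [MeasurableSpace 𝒵] {S : Measure (Bool × 𝒵)} {η : 𝒵 → ℝ}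
  {ν : Measure ℝ} {p ε : ℝ}

lemma ae_score_mem_Ioo (hηm : Measurable η) (hw : IsWeakScreening S η ν p ε) :
    ∀ᵐ z ∂S.snd, η z ∈ Ioo (0 : ℝ) 1 := by
  obtain ⟨ρ, h1, -, h3⟩ := hw
  rw [← h1, Measure.fst, ae_map_iff measurable_fst.aemeasurable (hηm measurableSet_Ioo)]
  exact h3.mono fun x hx => hx.1

lemma ae_score_eq_of_strength_zero (hηm : Measurable η) (hp : p ∈ Ioo (0 : ℝ) 1)
    (hw : IsWeakScreening S η ν p 0) : ∀ᵐ z ∂S.snd, η z = p := by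
  obtain ⟨ρ, h1, -, h3⟩ := hw
  rw [← h1, Measure.fst, ae_map_iff measurable_fst.aemeasurable
    (measurableSet_eq_fun hηm measurable_const)]
  refine h3.mono fun x hx => ?_
  have h := hx.2
  rw [zero_mul, add_zero] at h
  rw [eq_sigmoid_of_logit hx.1 h, ← eq_sigmoid_of_logit hp rfl]

/-- For positive strength the standardized score is a function of the screening statistic. -/
lemma exists_standardized_score (hηm : Measurable η) (hε : 0 < ε)
    (hw : IsWeakScreening S η ν p ε) :
    ∃ G : 𝒵 → ℝ, Measurable G ∧ S.snd.map G = ν ∧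
      ∀ᵐ z ∂S.snd, η z = Real.sigmoid (Real.log (p / (1 - p)) + ε * G z) := by
  have h01 := ae_score_mem_Ioo hηm hw
  obtain ⟨ρ, h1, h2, h3⟩ := hw
  let G : 𝒵 → ℝ := fun z => (Real.log (η z / (1 - η z)) - Real.log (p / (1 - p))) / ε
  have hG : Measurable G := by fun_prop
  refine ⟨G, hG, ?_, ?_⟩
  · rw [← h1, Measure.fst, Measure.map_map hG measurable_fst, ← h2, Measure.snd]
    refine Measure.map_congr (h3.mono fun x hx => ?_)
    simp only [Function.comp, G, hx.2]
    field_simp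
    ring
  · refine h01.mono fun z hz => eq_sigmoid_of_logit hz ?_
    simp only [G]
    field_simp
    ring

lemma integrable_pow_of_integrable_cube [IsProbabilityMeasure ν]
    (hG3 : Integrable (fun g : ℝ => |g| ^ 3) ν) : Integrable (fun g : ℝ => g ^ 2) ν := by
  refine ((integrable_const (1 : ℝ)).add hG3).mono' (by fun_prop) (ae_of_all _ fun g => ?_)
  simp only [Pi.add_apply, Real.norm_eq_abs, abs_pow]
  rcases le_total |g| 1 with h | h
  · have := pow_le_one₀ (abs_nonneg g) h (n := 2)
    have := pow_nonneg (abs_nonneg g) 3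
    linarith
  · have := pow_le_pow_right₀ h (show 2 ≤ 3 by norm_num)
    linarith

variable [IsProbabilityMeasure S]

lemma mutualInfoBits_eq_zero_of_strength_zero (hη : IsBayesScore S η) (hp : p ∈ Ioo (0 : ℝ) 1)
    (hw : IsWeakScreening S η ν p 0) : mutualInfoBits S = 0 := by
  have h01 := ae_score_mem_Ioo hη.1 hw
  have he := ae_score_eq_of_strength_zero hη.1 hp hw
  have h1 : ∫ z, binaryKL (η z) p ∂S.snd = 0 := by
    rw [integral_congr_ae (he.mono fun z hz => by rw [hz, binaryKL_self hp])]
    simp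
  have h2 : ∫ z, η z ∂S.snd = p := by
    rw [integral_congr_ae he]; simp
  have h := mutualInfoBits_mul_log_two_eq_sub hη h01 hp
  rw [h1, h2, binaryKL_self hp, sub_zero] at h
  exact (mul_eq_zero.1 h).resolve_right (Real.log_pos one_lt_two).ne'

variable [IsProbabilityMeasure ν]

/-- The mutual information of type and screening statistic to second order in the strength. -/
lemma mutualInfoBits_screening_bounds (hη : IsBayesScore S η) (hp : p ∈ Ioo (0 : ℝ) 1)
    (hε : 0 < ε) (hw : IsWeakScreening S η ν p ε) (hG3 : Integrable (fun g : ℝ => |g| ^ 3) ν)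
    (hG1 : ∫ g, g ∂ν = 0) (hG2 : ∫ g, g ^ 2 ∂ν = 1) :
    mutualInfoBits S * Real.log 2 ≤ p * (1 - p) * ε ^ 2 / 2 + ε ^ 3 * ∫ g, |g| ^ 3 ∂ν ∧
    p * (1 - p) * ε ^ 2 / 2 - ε ^ 3 * ∫ g, |g| ^ 3 ∂ν - ε ^ 4 / (p * (1 - p))
      ≤ mutualInfoBits S * Real.log 2 := by
  have hηm := hη.1
  have h01 := ae_score_mem_Ioo hη.1 hw
  obtain ⟨G, hG, hGν, hηG⟩ := exists_standardized_score hη.1 hε hw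
  set x := Real.log (p / (1 - p)) with hx
  have hpx : p = Real.sigmoid x := eq_sigmoid_of_logit hp rfl
  have hG2i := integrable_pow_of_integrable_cube hG3
  have hG1i := integrable_id_of_integrable_sq ν hG2i
  have tr : ∀ f : ℝ → ℝ, Integrable f ν → Measurable f →
      Integrable (fun z => f (G z)) S.snd ∧ ∫ z, f (G z) ∂S.snd = ∫ g, f g ∂ν := by
    intro f hf hfm
    rw [← hGν] at hf ⊢
    exact ⟨hf.comp_measurable hG, (integral_map hG.aemeasurable hfm.aestronglyMeasurable).symm⟩
  obtain ⟨i1, e1⟩ := tr _ hG1i measurable_id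
  obtain ⟨i2, e2⟩ := tr _ hG2i (by fun_prop)
  obtain ⟨i3, e3⟩ := tr _ hG3 (by fun_prop)
  rw [hG1] at e1
  rw [hG2] at e2
  have hint := integrable_score hη h01
  set b := ∫ z, η z ∂S.snd with hb
  have hb01 : b ∈ Ioo (0 : ℝ) 1 := integral_mem_Ioo hint h01
  -- The linear term of the expansion has mean zero, so the prior probability is off by second order
  -- only.
  have hbp : |b - p| ≤ ε ^ 2 := by
    have hi0 : Integrable (fun z => η z - p) S.snd := hint.sub (integrable_const p)
    have hi : Integrable (fun z => η z - p - p * (1 - p) * (ε * G z)) S.snd :=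
      hi0.sub ((i1.const_mul ε).const_mul _)
    have h1 : ∫ z, (η z - p - p * (1 - p) * (ε * G z)) ∂S.snd = b - p := by
      rw [integral_sub hi0 ((i1.const_mul ε).const_mul _), integral_const_mul,
        integral_const_mul, e1, integral_sub hint (integrable_const p)]
      simp [hb]
    rw [← h1]
    calc _ ≤ ∫ z, |η z - p - p * (1 - p) * (ε * G z)| ∂S.snd := abs_integral_le_integral_abs
      _ ≤ ∫ z, ε ^ 2 * G z ^ 2 ∂S.snd := by
        refine integral_mono_ae hi.abs (i2.const_mul _) (hηG.mono fun z hz => ?_)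
        simp only
        rw [hz, hpx, ← mul_pow]
        exact abs_sigmoid_sub_linear_le x _
      _ = ε ^ 2 := by rw [integral_const_mul, e2, mul_one]
  obtain ⟨j1, j2⟩ := integrable_binaryKL hη h01 hp
  have j3 : Integrable (fun z => binaryKL (η z) p) S.snd := j1.add j2
  have hkl : |∫ z, binaryKL (η z) p ∂S.snd - p * (1 - p) * ε ^ 2 / 2|
      ≤ ε ^ 3 * ∫ g, |g| ^ 3 ∂ν := by
    have j4 := i2.const_mul (p * (1 - p) * ε ^ 2 / 2)
    have h1 : ∫ z, (binaryKL (η z) p - p * (1 - p) * ε ^ 2 / 2 * G z ^ 2) ∂S.snd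
        = ∫ z, binaryKL (η z) p ∂S.snd - p * (1 - p) * ε ^ 2 / 2 := by
      rw [integral_sub j3 j4, integral_const_mul, e2, mul_one]
    rw [← h1]
    calc _ ≤ ∫ z, |binaryKL (η z) p - p * (1 - p) * ε ^ 2 / 2 * G z ^ 2| ∂S.snd :=
          abs_integral_le_integral_abs
      _ ≤ ∫ z, ε ^ 3 * |G z| ^ 3 ∂S.snd := by
        refine integral_mono_ae (j3.sub j4).abs (i3.const_mul _) (hηG.mono fun z hz => ?_)
        simp only
        have h2 := abs_binaryKL_sigmoid_sub_le x (ε * G z)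
        rw [← hz, ← hpx, abs_mul, abs_of_pos hε, mul_pow, mul_pow] at h2
        rwa [show p * (1 - p) * (ε ^ 2 * G z ^ 2) / 2 = p * (1 - p) * ε ^ 2 / 2 * G z ^ 2
          by ring] at h2
      _ = _ := by rw [integral_const_mul, e3]
  -- The subtracted divergence of `b` from `p` lies between 0 and `ε ^ 4 / (p (1 - p))`: dropping it
  -- gives the upper bound, and the chi-square estimate `binaryKL_le` gives the lower one.
  rw [mutualInfoBits_mul_log_two_eq_sub hη h01 hp, ← hb]
  have hv : 0 < p * (1 - p) := mul_pos hp.1 (by linarith [hp.2])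
  have h3 := binaryKL_nonneg hb01 hp
  have h4 := binaryKL_le hb01 hp
  have h5 : (b - p) ^ 2 / (p * (1 - p)) ≤ ε ^ 4 / (p * (1 - p)) := by
    gcongr
    rw [← sq_abs]
    calc |b - p| ^ 2 ≤ (ε ^ 2) ^ 2 := by gcongr
      _ = _ := by ring
  obtain ⟨h6, h7⟩ := abs_le.1 hkl
  constructor <;> linarith

/-- A lower bound for the expected number of informative records among the selected ones. -/
lemma le_integral_sum_selection [NullSingletonClass ν] (hη : IsBayesScore S η)
    (hp : p ∈ Ioo (0 : ℝ) 1) (hε : 0 < ε) (hw : IsWeakScreening S η ν p ε)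
    (hG2i : Integrable (fun g : ℝ => g ^ 2) ν) (hG2 : ∫ g, g ^ 2 ∂ν = 1) {α : ℝ}
    (hα : α ∈ Ioo (0 : ℝ) 1) {K B : ℕ} (hK : 0 < K) (hB1 : (B : ℝ) ≤ α * K)
    (hB2 : α * K < B + 1) {τ : ℝ} (hτ : 0 < τ)
    (hKτ : (1 / (2 * τ ^ 2) + 1) / (2 * τ) ≤ τ / 4 * K) {sel : (Fin K → 𝒵) → Finset (Fin K)}
    (hsel : IsTopSelection η B sel) :
    B * p + p * (1 - p) * ε * (K * (α * tailMean ν α - τ)) - ε ^ 2 * K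
      ≤ ∫ z, ∑ i ∈ sel z, η (z i) ∂(Measure.pi fun _ : Fin K => S.snd) := by
  classical
  have h01 := ae_score_mem_Ioo hη.1 hw
  obtain ⟨G, hG, hGν, hηG⟩ := exists_standardized_score hη.1 hε hw
  set x := Real.log (p / (1 - p)) with hx
  have hpx : p = Real.sigmoid x := eq_sigmoid_of_logit hp rfl
  have hv : 0 < p * (1 - p) := mul_pos hp.1 (by linarith [hp.2])
  let A : (Fin K → ℝ) → Finset (Fin K) := fun g =>
    Finset.univ.filter fun i => upperQuantile ν α ≤ g i
  obtain ⟨i1, e1, i2, e2⟩ := le_integral_tail ν hG2i hG2 hα hK hB1 hB2 hτ hKτ (A := A)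
    (by simp [A])
  -- A pathwise lower bound for the selected sum that depends on the standardized scores alone and
  -- not on `sel`, so its mean is computed under the product of `ν`.
  let R : (Fin K → ℝ) → ℝ := fun g => B * p + p * (1 - p) * ε * (∑ i ∈ A g, g i
    - τ / 2 * ∑ i, g i ^ 2 - |((A g).card : ℝ) - B| / (2 * τ)) - ε ^ 2 * ∑ i, g i ^ 2
  have i4 : Integrable (fun g : Fin K → ℝ => (B : ℝ) * p + p * (1 - p) * ε * (∑ i ∈ A g, g i
      - τ / 2 * ∑ i, g i ^ 2 - |((A g).card : ℝ) - B| / (2 * τ))) (Measure.pi fun _ => ν) :=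
    (integrable_const _).add (i2.const_mul _)
  have hR : Integrable R (Measure.pi fun _ => ν) := i4.sub (i1.const_mul _)
  have hmap : (Measure.pi fun _ : Fin K => S.snd).map (fun z i => G (z i))
      = Measure.pi fun _ => ν := by
    have h := Measure.pi_map_pi (μ := fun _ : Fin K => S.snd) (f := fun _ => G)
      fun _ => hG.aemeasurable
    simp only [hGν] at h
    exact h
  have hRint : ∫ z : Fin K → 𝒵, R (fun i => G (z i)) ∂(Measure.pi fun _ => S.snd)
      = ∫ g, R g ∂(Measure.pi fun _ => ν) := by
    rw [← hmap, integral_map (Measurable.aemeasurable (by fun_prop))]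
    rw [hmap]; exact hR.aestronglyMeasurable
  have hRi : Integrable (fun z : Fin K → 𝒵 => R (fun i => G (z i)))
      (Measure.pi fun _ => S.snd) := by
    rw [← hmap] at hR
    exact hR.comp_measurable (by fun_prop)
  have hle : ∫ z : Fin K → 𝒵, R (fun i => G (z i)) ∂(Measure.pi fun _ => S.snd)
      ≤ ∫ z, ∑ i ∈ sel z, η (z i) ∂(Measure.pi fun _ : Fin K => S.snd) := by
    refine integral_mono_ae hRi
      (integrable_sum_selection hη.1 hsel.measurableSet_fiber (ae_pi_forall h01)) ?_
    filter_upwards [ae_pi_forall (K := K) hηG] with z hz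
    have h := sum_top_ge (A fun i => G (z i)) (s := sel z) (h := fun i => η (z i))
      (g := fun i => G (z i)) (p := p) (v := p * (1 - p)) hv.le hε.le hτ (hsel.score_le z)
      (fun i => by
        have h1 := (abs_le.1 (abs_sigmoid_sub_linear_le x (ε * G (z i)))).1
        rw [← hz i, ← hpx] at h1
        linarith)
    rw [hsel.card_eq] at h
    exact h
  rw [hRint, integral_sub i4 (i1.const_mul _),
    integral_add (integrable_const _) (i2.const_mul _),
    integral_const_mul (p * (1 - p) * ε), integral_const_mul (ε ^ 2), e1] at hle
  simp only [integral_const, probReal_univ, one_smul] at hle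
  have h5 := mul_le_mul_of_nonneg_left e2 (mul_nonneg hv.le hε.le)
  linarith

end WeakScreening

/-- The expected number of informative records among the selected ones, in terms of the mutual
information of type and screening statistic. -/
lemma expected_informative_ge {p : ℝ} (hp : p ∈ Ioo (0 : ℝ) 1) {α : ℝ} (hα : α ∈ Ioo (0 : ℝ) 1)
    (ν : Measure ℝ) [IsProbabilityMeasure ν] [NullSingletonClass ν]
    (hG3 : Integrable (fun g : ℝ => |g| ^ 3) ν)
    (hG1 : ∫ g, g ∂ν = 0) (hG2 : ∫ g, g ^ 2 ∂ν = 1) {δ : ℝ} (hδ : 0 < δ) :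
    ∃ ε₀ : ℝ, 0 < ε₀ ∧ ∃ K₀ : ℕ, ∀ ε : ℝ, 0 ≤ ε → ε ≤ ε₀ → ∀ K : ℕ, K₀ ≤ K →
      ∀ (𝒵 : Type*) [MeasurableSpace 𝒵] (S : Measure (Bool × 𝒵)) [IsProbabilityMeasure S]
        (η : 𝒵 → ℝ), IsBayesScore S η → IsWeakScreening S η ν p ε →
      ∀ (B : ℕ), B = ⌊α * (K : ℝ)⌋₊ →
      ∀ (sel : (Fin K → 𝒵) → Finset (Fin K)), IsTopSelection η B sel →
        B * p + (gainConst ν p α - δ) * Real.sqrt (mutualInfoBits S * K * B)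
          ≤ ∫ z, ∑ i ∈ sel z, η (z i) ∂(Measure.pi fun _ : Fin K => S.snd) := by
  have hv : 0 < p * (1 - p) := mul_pos hp.1 (by linarith [hp.2])
  set v := p * (1 - p) with hvdef
  have hα0 := hα.1
  have hL : 0 < Real.log 2 := Real.log_pos one_lt_two
  set L := Real.log 2
  have hG2i := integrable_pow_of_integrable_cube hG3
  have hG1i := integrable_id_of_integrable_sq ν hG2i
  have hm := tailMean_nonneg ν hG1i hG1 hα0
  set m := tailMean ν α with hmdef
  set M := ∫ g, |g| ^ 3 ∂ν with hMdef
  have hM : 0 ≤ M := integral_nonneg fun g => by positivity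
  -- Chosen so that `c ε K ≤ √(J K B)`, from `J ≥ v ε² / (8 L)` and `B ≥ α K / 2`. The allowance is
  -- thus at least `δ c ε K`; taking `v τ = δ c / 2` spends half of it on the tail error.
  set c := Real.sqrt (v * α / (16 * L)) with hc
  have hc0 : 0 < c := Real.sqrt_pos.2 (by positivity)
  set τ := δ * c / (2 * v) with hτdef
  have hτ : 0 < τ := by positivity
  obtain ⟨K₁, hK₁⟩ := exists_nat_ge (max (2 / α) ((1 / (2 * τ ^ 2) + 1) / (2 * τ) * (4 / τ)))
  -- The bound 1 gives `ε ^ 4 ≤ ε ^ 3`. The second gives `ε (M + 1 / v) ≤ 3 v / 8`, which leaves `J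
  -- L ≥ v ε² / 8`. The third lets the other half of the allowance cover `ε² K` and the cubic error
  -- in `J`.
  refine ⟨min (min 1 (v / 4 / (M + 1 / v) * (3 / 2))) (δ * c / (2 * (1 + m * α * M))), by positivity,
    K₁ + 1, ?_⟩
  intro ε hε0 hε1 K hK 𝒵 _ S _ η hη hw B hB sel hsel
  have hKpos : 0 < K := by omega
  have hKR : (0 : ℝ) < K := by exact_mod_cast hKpos
  have hKK : (K₁ : ℝ) ≤ K := by exact_mod_cast (by omega : K₁ ≤ K)
  have hK2 : 2 / α ≤ K := (le_max_left _ _).trans (hK₁.trans hKK)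
  have hK3 := (le_max_right _ _).trans (hK₁.trans hKK)
  have hB1 : (B : ℝ) ≤ α * K := by rw [hB]; exact Nat.floor_le (by positivity)
  have hB2 : α * K < B + 1 := by rw [hB]; exact Nat.lt_floor_add_one _
  rcases hε0.eq_or_lt with rfl | hε
  -- At `ε = 0` the score no longer determines `G`, but all scores equal `p` and `J = 0`, so both
  -- sides are `B p`.
  · have he := ae_score_eq_of_strength_zero hη.1 hp hw
    rw [mutualInfoBits_eq_zero_of_strength_zero hη hp hw,
      integral_congr_ae ((ae_pi_forall (K := K) he).mono fun z hz =>
        Finset.sum_congr rfl fun i _ => hz i)]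
    simp [hsel.card_eq]
  have hKτ : (1 / (2 * τ ^ 2) + 1) / (2 * τ) ≤ τ / 4 * K := by
    rw [mul_div_assoc', div_le_iff₀ hτ] at hK3
    linarith
  have hlow := le_integral_sum_selection hη hp hε hw hG2i hG2 hα hKpos hB1 hB2 hτ hKτ hsel
  refine le_trans ?_ hlow
  obtain ⟨hJ1, hJ2⟩ := mutualInfoBits_screening_bounds hη hp hε hw hG3 hG1 hG2
  rw [← hvdef] at hJ1 hJ2 ⊢
  rw [← hMdef] at hJ1 hJ2
  rw [← hmdef]
  set J := mutualInfoBits S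
  have hε1' : ε ≤ 1 := hε1.trans ((min_le_left _ _).trans (min_le_left _ _))
  have hε2 : ε * (M + 1 / v) ≤ 3 / 8 * v := by
    have h := hε1.trans ((min_le_left _ _).trans (min_le_right _ _))
    have h0 : 0 < M + 1 / v := by positivity
    calc ε * (M + 1 / v) ≤ (v / 4 / (M + 1 / v) * (3 / 2)) * (M + 1 / v) := by gcongr
      _ = _ := by field_simp; norm_num
  have hε3 : ε * (1 + m * α * M) ≤ δ * c / 2 := by
    have h := hε1.trans (min_le_right _ _)
    have h0 : 0 < 1 + m * α * M := by positivity
    calc _ ≤ δ * c / (2 * (1 + m * α * M)) * (1 + m * α * M) := by gcongr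
      _ = _ := by field_simp
  have hJlow : v * ε ^ 2 / 8 ≤ J * L := by
    refine le_trans ?_ hJ2
    have h1 : ε ^ 4 / v ≤ ε ^ 3 / v := by
      gcongr ?_ / v
      exact pow_le_pow_of_le_one hε.le hε1' (by norm_num)
    have h2 : ε ^ 3 * M + ε ^ 3 / v = ε ^ 2 * (ε * (M + 1 / v)) := by ring
    have h3 := mul_le_mul_of_nonneg_left hε2 (sq_nonneg ε)
    linarith
  have hJ0 : 0 ≤ J := by
    by_contra! h
    have : 0 ≤ v * ε ^ 2 / 8 := by positivity
    have := mul_neg_of_neg_of_pos h hL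
    linarith
  have hBlow : α * K / 2 ≤ B := by
    rw [div_le_iff₀ hα0] at hK2
    linarith
  have hs1 : c * ε * K ≤ Real.sqrt (J * K * B) := by
    refine Real.le_sqrt_of_sq_le ?_
    have h1 : v * ε ^ 2 / (8 * L) ≤ J := by
      rw [div_le_iff₀ (by positivity)]
      linarith
    calc (c * ε * K) ^ 2 = v * ε ^ 2 / (8 * L) * K * (α * K / 2) := by
          rw [mul_pow, mul_pow, hc, Real.sq_sqrt (by positivity)]
          field_simp
          norm_num
      _ ≤ J * K * B := by gcongr
  -- Insert the upper bounds on `J` and `B` under the root and complete the square: `v² + 2 v ε M ≤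
  -- (v + ε M)²`.
  have hs2 : gainConst ν p α * Real.sqrt (J * K * B) ≤ m * (α * K * ε * (v + ε * M)) := by
    rw [gainConst, ← hmdef, mul_right_comm, ← Real.sqrt_mul (by positivity), mul_comm _ m]
    refine mul_le_mul_of_nonneg_left (Real.sqrt_le_iff.2 ⟨by positivity, ?_⟩) hm
    calc 2 * L * (p * (1 - p)) * α * (J * K * B)
        = 2 * v * α * (J * L) * K * B := by rw [hvdef]; ring
      _ ≤ 2 * v * α * (v * ε ^ 2 / 2 + ε ^ 3 * M) * K * (α * K) := by gcongr
      _ = (α * K * ε) ^ 2 * (v ^ 2 + 2 * v * (ε * M)) := by ring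
      _ ≤ (α * K * ε) ^ 2 * (v + ε * M) ^ 2 := by
          gcongr
          nlinarith [sq_nonneg (ε * M)]
      _ = _ := by ring
  have hs3 := mul_le_mul_of_nonneg_left hs1 hδ.le
  have hvτ : v * τ = δ * c / 2 := by rw [hτdef]; field_simp
  have hfin : ε * K * (ε * (1 + m * α * M)) ≤ ε * K * (δ * c / 2) := by gcongr
  have hvτ' : ε * K * (v * τ) = ε * K * (δ * c / 2) := by rw [hvτ]
  linarith

end ScoreVerification

theorem theorem2
    {𝒯 : Type*} [Fintype 𝒯] [MeasurableSpace 𝒯] [MeasurableSingletonClass 𝒯]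
    {𝒱 : Type*} [MeasurableSpace 𝒱]
    -- the prior of each claim
    (prior : Measure 𝒯) [IsProbabilityMeasure prior]
    -- the verification channel; for `T = 0` its output does not depend on the claim
    (ver : Kernel (𝒯 × Bool) 𝒱) [IsMarkovKernel ver]
    (hver : ∃ ν₀ : Measure 𝒱, ∀ᵐ θ ∂prior, ver (θ, false) = ν₀)
    (p : ℝ) (hp : p ∈ Ioo (0 : ℝ) 1)
    (α : ℝ) (hα : α ∈ Ioo (0 : ℝ) 1)
    -- the law of `G`
    (ν : Measure ℝ) [IsProbabilityMeasure ν] [NullSingletonClass ν]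
    (hG3 : Integrable (fun g : ℝ => |g| ^ 3) ν)
    (hG1 : ∫ g, g ∂ν = 0) (hG2 : ∫ g, g ^ 2 ∂ν = 1) :
    -- the remainder is `o(√(J K B))` in the joint limit `ε → 0`, `K → ∞`
    ∀ δ : ℝ, 0 < δ → ∃ ε₀ : ℝ, 0 < ε₀ ∧ ∃ K₀ : ℕ,
      ∀ ε : ℝ, 0 ≤ ε → ε ≤ ε₀ → ∀ K : ℕ, K₀ ≤ K →
      ∀ (𝒵 : Type*) [MeasurableSpace 𝒵]
        -- the joint law of `(T, Z)`; `P(T = 1)` need not be exactly `p`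
        (S : Measure (Bool × 𝒵)) [IsProbabilityMeasure S]
        (η : 𝒵 → ℝ), IsBayesScore S η → IsWeakScreening S η ν p ε →
      ∀ (B : ℕ), B = ⌊α * (K : ℝ)⌋₊ →
      ∀ (sel : (Fin K → 𝒵) → Finset (Fin K)), IsTopSelection η B sel →
        min (claimEntropy prior K)
            (verInfo prior ver * ((B : ℝ) * p
              + gainConst ν p α * Real.sqrt (mutualInfoBits S * (K : ℝ) * (B : ℝ))))
          - δ * Real.sqrt (mutualInfoBits S * (K : ℝ) * (B : ℝ))
        ≤ gain prior ver S sel := by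
  intro δ hδ
  have hI0 := verInfo_nonneg prior ver
  set I := verInfo prior ver
  -- Multiplication by `I` turns the error `δ / (I + 1)` into at most `δ`; the shift by 1 covers `I
  -- = 0`.
  obtain ⟨ε₀, hε₀, K₀, h⟩ := expected_informative_ge hp hα ν hG3 hG1 hG2
    (δ := δ / (I + 1)) (by positivity)
  refine ⟨ε₀, hε₀, K₀, ?_⟩
  intro ε hε0 hε1 K hK 𝒵 _ S _ η hη hw B hB sel hsel
  have : Nonempty 𝒯 := nonempty_of_isProbabilityMeasure prior
  have h1 := h ε hε0 hε1 K hK 𝒵 S η hη hw B hB sel hsel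
  have h2 := verInfo_mul_le_gain prior ver sel hsel.measurableSet_fiber hη
    (ae_score_mem_Ioo hη.1 hw)
  refine le_trans ?_ h2
  have h3 := mul_le_mul_of_nonneg_left h1 hI0
  have h4 : I * (δ / (I + 1)) ≤ δ := by
    rw [mul_div_assoc', div_le_iff₀ (by positivity)]
    nlinarith
  have h5 := mul_le_mul_of_nonneg_right h4 (Real.sqrt_nonneg (mutualInfoBits S * K * B))
  have h6 := min_le_right (claimEntropy prior K) (I * ((B : ℝ) * p
    + gainConst ν p α * Real.sqrt (mutualInfoBits S * (K : ℝ) * (B : ℝ))))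
  linarith
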